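/- An \emph{assembly graph} is a finite connected graph (loops and multiple edges allowed, a loop counted twice in the degree) in which every vertex has degree $1$ (an \emph{endpoint}) or $4$, and every vertex of degree $4$ is \emph{rigid}: a cyclic order $(h_1,h_2,h_3,h_4)$, up to rotation and reversal, of its four incident half-edges is fixed. Cyclically consecutive half-edges in this order are called \emph{neighbours}. Isomorphisms are pairs of bijections of vertices and of half-edges that preserve incidence, edges, and the cyclic orders at the rigid vertices. A \emph{transverse path} is a path between endpoints with pairwise distinct edges such that, at each intermediate vertex, the half-edge by which it arrives and the half-edge by which it leaves are not neighbours. An assembly graph is \emph{simple} if it has a transverse path that visits every edge exactly once. A \emph{polygonal path} is a path $v_0e_1v_1\dots e_\ell v_\ell$ ($\ell\ge 0$) with pairwise distinct vertices, all of degree $4$, such that $e_i$ and $e_{i+1}$ are neighbours in $v_i$ for $1\le i\le \ell-1$; a path and its reverse are considered equal. A \emph{Hamiltonian set of polygonal paths} is a set of pairwise vertex-disjoint polygonal paths that together cover all vertices of degree $4$; let $\mathcal C(\Gamma)$ be the collection of all such sets in $\Gamma$. A word in which each of its letters occurs exactly twice determines, up to isomorphism, a simple assembly graph: its letters are the vertices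 of degree $4$, and the word lists these vertices in the order in which a transverse path through all edges visits them. The \emph{tangled cord} $TC_n$ ($n\ge 1$) is the simple assembly graph of the word $1\,2\,1\,3\,2\,4\,3\cdots(n-1)(n-2)\,n\,(n-1)\,n$ (so $TC_1,TC_2,TC_3$ come from $11$, $1212$, $121323$). Let $F_0=0$, $F_1=1$, $F_k=F_{k-1}+F_{k-2}$. \textbf{Corollary.} Let $n\ge 1$ and let $\Gamma$ be a simple assembly graph with exactly $n$ vertices of degree $4$. Then $|\mathcal C(\Gamma)|\le F_{2n+1}-1$, and $|\mathcal C(\Gamma)|=F_{2n+1}-1$ if and only if $\Gamma$ is isomorphic to $TC_n$. -/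

import Mathlib

/-- The cyclic order determined by a tuple of four half-edges: the set of all its cyclic
permutations and their reverses. -/
def cyclicOrder {H : Type*} (e : Fin 4 → H) : Set (Fin 4 → H) :=
  {![e 0, e 1, e 2, e 3], ![e 1, e 2, e 3, e 0], ![e 2, e 3, e 0, e 1], ![e 3, e 0, e 1, e 2],
   ![e 3, e 2, e 1, e 0], ![e 2, e 1, e 0, e 3], ![e 1, e 0, e 3, e 2], ![e 0, e 3, e 2, e 1]}

/-- An assembly graph with vertex set `V` and set of half-edges `H` (both are assumed finite where
the notion is used): a connected graph, loops and multiple edges allowed, all of whose vertices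
have degree `1` or `4`, with a cyclic order of the half-edges fixed at every vertex of degree `4`.
The half-edge `h` is attached to the vertex `vert h`, and `h` and `opp h` are the two halves of
one edge. -/
structure AssemblyGraph (V H : Type*) where
  vert : H → V
  opp : H → H
  opp_opp : ∀ h, opp (opp h) = h
  opp_ne : ∀ h, opp h ≠ h
  /-- the cyclic order at a vertex (empty at the vertices of degree `1`, which are not rigid) -/
  order : V → Set (Fin 4 → H)
  degree_eq : ∀ v, {h | vert h = v}.ncard = 1 ∨ {h | vert h = v}.ncard = 4
  order_endpoint : ∀ v, {h | vert h = v}.ncard = 1 → order v = ∅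
  order_rigid : ∀ v, {h | vert h = v}.ncard = 4 →
    ∃ e : Fin 4 → H, Function.Injective e ∧ Set.range e = {h | vert h = v} ∧
      order v = cyclicOrder e
  connected : (SimpleGraph.fromRel fun u v => ∃ h, vert h = u ∧ vert (opp h) = v).Connected

namespace AssemblyGraph

variable {V H : Type*} (Γ : AssemblyGraph V H)

/-- The degree of a vertex: the number of half-edges attached to it (a loop counts twice). -/
noncomputable def degree (v : V) : ℕ := {h | Γ.vert h = v}.ncard

/-- The number of vertices of degree `4`. -/
noncomputable def numRigid : ℕ := {v | Γ.degree v = 4}.ncard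

/-- The edge containing the half-edge `h`, as the unordered pair of its two halves. -/
def edge (h : H) : Sym2 H := s(h, Γ.opp h)

/-- Two half-edges are neighbours if they are adjacent in the cyclic order at some vertex.
As `order v` is closed under rotation and reversal, it is enough to look at entries `0`, `1`. -/
def Neighbours (h h' : H) : Prop := ∃ v, ∃ t ∈ Γ.order v, t 0 = h ∧ t 1 = h'

/-- A (directed) path `v₀ e₁ v₁ … e_ℓ v_ℓ`. Each edge is recorded by the half-edge by which the path
leaves: an entry `h` of `halves` means that the path goes from `vert h` to `vert (opp h)` along the
edge of `h`. With `halves = []` it is the singleton path at `start`. -/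
@[ext]
structure Path where
  start : V
  halves : List H
  start_eq : ∀ h ∈ halves.head?, Γ.vert h = start
  chain : halves.IsChain fun h h' => Γ.vert (Γ.opp h) = Γ.vert h'

namespace Path

variable {Γ}

/-- The list `v₀, v₁, …, v_ℓ` of vertices of a path. -/
def support (p : Γ.Path) : List V := p.start :: p.halves.map fun h => Γ.vert (Γ.opp h)

/-- The last vertex of a path. -/
def finish (p : Γ.Path) : V := p.support.getLast (List.cons_ne_nil _ _)

/-- The list `e₁, …, e_ℓ` of edges of a path. -/
def edges (p : Γ.Path) : List (Sym2 H) := p.halves.map Γ.edge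

/-- The same path traversed backwards. -/
def reverse (p : Γ.Path) : Γ.Path where
  start := p.finish
  halves := (p.halves.map Γ.opp).reverse
  start_eq := by
    intro h hh
    rcases List.eq_nil_or_concat p.halves with hp | ⟨l, a, hp⟩
    · simp [hp] at hh
    · simp [hp] at hh
      simp [finish, support, hp, ← hh]
  chain := by
    rw [List.isChain_reverse, List.isChain_map]
    refine p.chain.imp fun a b hab => ?_
    simp [Γ.opp_opp, hab]

theorem support_reverse (p : Γ.Path) : p.reverse.support = p.support.reverse := by
  obtain ⟨v, l, h0, hc⟩ := p
  induction l generalizing v with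
  | nil => simp [support, reverse, finish]
  | cons a l ih =>
    have ha : Γ.vert a = v := h0 a (by simp)
    have h1 : ∀ h ∈ l.head?, Γ.vert h = Γ.vert (Γ.opp a) := by
      intro h hh
      cases l with
      | nil => simp at hh
      | cons b l =>
        simp at hh hc
        rw [← hh, hc.1]
    have := ih (Γ.vert (Γ.opp a)) h1 hc.tail
    simp only [support, reverse, finish, List.map_cons, List.reverse_cons, List.map_append,
      List.map_nil, List.getLast_cons_cons, Γ.opp_opp, ha] at this ⊢
    rw [← List.cons_append, this]

theorem mem_support_reverse (p : Γ.Path) (v : V) : v ∈ p.reverse.support ↔ v ∈ p.support := by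
  simp [support_reverse]

theorem reverse_reverse (p : Γ.Path) : p.reverse.reverse = p := by
  ext1
  · have h : p.reverse.support.getLast (List.cons_ne_nil _ _) = p.start := by
      have h' := p.support_reverse
      simp only [h']
      simp [support]
    exact h
  · simp [reverse, List.map_reverse, Function.comp_def, Γ.opp_opp]

/-- A transverse path: it joins two endpoints, its edges are pairwise distinct, and at each
intermediate vertex the half-edge by which it arrives and the half-edge by which it leaves are not
neighbours. -/
def IsTransverse (p : Γ.Path) : Prop :=
  Γ.degree p.start = 1 ∧ Γ.degree p.finish = 1 ∧ p.edges.Nodup ∧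
    p.halves.IsChain fun h h' => ¬ Γ.Neighbours (Γ.opp h) h'

/-- A transverse path that visits every edge (exactly once, since its edges are distinct). -/
def IsEulerianTransverse (p : Γ.Path) : Prop :=
  p.IsTransverse ∧ ∀ h, Γ.edge h ∈ p.edges

/-- A polygonal path: its vertices are pairwise distinct and of degree `4`, and consecutive edges
are neighbours in their common vertex. -/
def IsPolygonal (p : Γ.Path) : Prop :=
  p.support.Nodup ∧ (∀ v ∈ p.support, Γ.degree v = 4) ∧
    p.halves.IsChain fun h h' => Γ.Neighbours (Γ.opp h) h'

end Path

/-- An assembly graph is simple if it has a transverse path visiting each edge exactly once. -/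
def IsSimple : Prop := ∃ p : Γ.Path, p.IsEulerianTransverse

/-- Polygonal paths are identified with their reverses. -/
def polygonalSetoid : Setoid {p : Γ.Path // p.IsPolygonal} where
  r p q := p = q ∨ p.1 = q.1.reverse
  iseqv :=
    { refl := fun _ => Or.inl rfl
      symm := by
        rintro p q (h | h)
        · exact Or.inl h.symm
        · exact Or.inr (by rw [h, Path.reverse_reverse])
      trans := by
        rintro p q r (h | h) (h' | h')
        · exact Or.inl (h.trans h')
        · exact Or.inr (by rw [h, h'])
        · exact Or.inr (by rw [h, h'])
        · exact Or.inl (Subtype.ext (by rw [h, h', Path.reverse_reverse])) }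

/-- An (undirected) polygonal path. -/
def PolygonalPath : Type _ := Quotient Γ.polygonalSetoid

/-- The set of vertices of an undirected polygonal path. -/
def PolygonalPath.verts {Γ : AssemblyGraph V H} (P : Γ.PolygonalPath) : Set V :=
  Quotient.lift (s := Γ.polygonalSetoid)
    (fun p : {p : Γ.Path // p.IsPolygonal} => {v | v ∈ p.1.support})
    (by
      rintro p q (h | h)
      · rw [h]
      · ext v
        simp only [Set.mem_ofPred_eq, h, Path.mem_support_reverse]) P

/-- The collection of all Hamiltonian sets of polygonal paths: sets of pairwise vertex-disjoint
polygonal paths that together cover all vertices of degree `4`. -/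
def hamiltonianSets : Set (Set Γ.PolygonalPath) :=
  {S | (S.Pairwise fun P Q => Disjoint P.verts Q.verts) ∧
    ∀ v, Γ.degree v = 4 → ∃ P ∈ S, v ∈ P.verts}

/-- An isomorphism of simple assembly graphs: bijections of the vertices and of the half-edges that
respect incidence, edges, and the cyclic orders at the rigid vertices. -/
structure Iso {V' H' : Type*} (Γ : AssemblyGraph V H) (Γ' : AssemblyGraph V' H') where
  onVert : V ≃ V'
  onHalf : H ≃ H'
  vert_comm : ∀ h, Γ'.vert (onHalf h) = onVert (Γ.vert h)
  opp_comm : ∀ h, Γ'.opp (onHalf h) = onHalf (Γ.opp h)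
  order_comm : ∀ v, Γ.degree v = 4 →
    ∀ t : Fin 4 → H, (fun i => onHalf (t i)) ∈ Γ'.order (onVert v) ↔ t ∈ Γ.order v

end AssemblyGraph

/-- A double occurrence word of length `N` over an alphabet `A` all of whose letters are used. -/
def IsDoubleOccurrence {A : Type*} {N : ℕ} (w : Fin N → A) : Prop :=
  ∀ a, {i | w i = a}.ncard = 2

namespace AssemblyGraph

variable {A : Type*} {N : ℕ}

/-- The vertex to which a half-edge of the graph of a word is attached; see `ofWord`. -/
def wordVert (w : Fin N → A) : Fin (N + 1) × Bool → A ⊕ Bool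
  | (i, false) => Fin.cases (Sum.inr false) (fun p => Sum.inl (w p)) i
  | (i, true) => Fin.lastCases (Sum.inr true) (fun p => Sum.inl (w p)) i

/-- The cyclic orders of the graph of a word; see `ofWord`. -/
def wordOrder (w : Fin N → A) : A ⊕ Bool → Set (Fin 4 → Fin (N + 1) × Bool)
  | Sum.inl a => {t | ∃ p q : Fin N, p ≠ q ∧ w p = a ∧ w q = a ∧
      t ∈ cyclicOrder ![(p.castSucc, true), (q.castSucc, true), (p.succ, false), (q.succ, false)]}
  | Sum.inr _ => ∅

theorem wordVert_eq_inl (w : Fin N → A) (a : A) {p q : Fin N} (hpq : {i | w i = a} = {p, q}) :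
    {h | wordVert w h = Sum.inl a} =
      Set.range ![(p.castSucc, true), (q.castSucc, true), (p.succ, false), (q.succ, false)] := by
  have key : ∀ i, w i = a ↔ i = p ∨ i = q := fun i => by
    simpa using congrArg (i ∈ ·) hpq
  ext ⟨i, b⟩
  cases b
  · refine Fin.cases ?_ (fun j => ?_) i
    · simp [wordVert, (Fin.succ_ne_zero _).symm]
    · simp [wordVert, key, or_comm]
  · refine Fin.lastCases ?_ (fun j => ?_) i
    · simp [wordVert, (Fin.castSucc_ne_last _).symm]
    · simp [wordVert, key, or_comm]

theorem wordVert_eq_inr (w : Fin N → A) (b : Bool) :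
    {h | wordVert w h = Sum.inr b} = {(if b then Fin.last N else 0, b)} := by
  ext ⟨i, c⟩
  cases c
  · refine Fin.cases ?_ (fun j => ?_) i <;> cases b <;> simp [wordVert, Fin.succ_ne_zero]
  · refine Fin.lastCases ?_ (fun j => ?_) i <;> cases b <;> simp [wordVert, Fin.castSucc_ne_last]

theorem injective_word {p q : Fin N} (h : p ≠ q) : Function.Injective
    ![(p.castSucc, true), (q.castSucc, true), (p.succ, false), (q.succ, false)] := by
  intro i j
  fin_cases i <;> fin_cases j <;> simp [h, h.symm]

theorem cyclicOrder_swap {H : Type*} (a b c d : H) :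
    cyclicOrder ![b, a, d, c] = cyclicOrder ![a, b, c, d] := by
  ext t
  simp only [cyclicOrder, Set.mem_insert_iff, Set.mem_singleton_iff]
  simp
  tauto

/-- The simple assembly graph of a double occurrence word `w`. It is the transversal
`initial endpoint, w 0, w 1, …, w (N - 1), terminal endpoint` with its `N + 1` edges, numbered by
`Fin (N + 1)`, whose vertices of degree `4` are the letters and whose endpoints are `Sum.inr false`
(initial) and `Sum.inr true` (terminal). The half-edges of the edge `i` are `(i, false)`, at its
beginning, and `(i, true)`, at its end. If a letter occurs at the positions `p ≠ q`, then the
half-edges arriving at and leaving the occurrence `p` are not neighbours, and similarly for `q`: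
the cyclic order is `(in p, in q, out p, out q)`. -/
def ofWord (w : Fin N → A) (hw : IsDoubleOccurrence w) :
    AssemblyGraph (A ⊕ Bool) (Fin (N + 1) × Bool) where
  vert := wordVert w
  opp h := (h.1, !h.2)
  opp_opp := by simp
  opp_ne := by rintro ⟨i, b⟩; simp
  order := wordOrder w
  degree_eq := by
    rintro (a | b)
    · obtain ⟨p, q, hne, hpq⟩ := Set.ncard_eq_two.1 (hw a)
      right
      rw [wordVert_eq_inl w a hpq, ← Set.image_univ,
        Set.ncard_image_of_injective _ (injective_word hne)]
      simp
    · left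
      rw [wordVert_eq_inr, Set.ncard_singleton]
  order_endpoint := by
    rintro (a | b) h
    · obtain ⟨p, q, hne, hpq⟩ := Set.ncard_eq_two.1 (hw a)
      rw [wordVert_eq_inl w a hpq, ← Set.image_univ,
        Set.ncard_image_of_injective _ (injective_word hne)] at h
      simp at h
    · rfl
  order_rigid := by
    rintro (a | b) h
    · obtain ⟨p, q, hne, hpq⟩ := Set.ncard_eq_two.1 (hw a)
      have key : ∀ i, w i = a ↔ i = p ∨ i = q := fun i => by
        simpa using congrArg (i ∈ ·) hpq
      refine ⟨_, injective_word hne, (wordVert_eq_inl w a hpq).symm, ?_⟩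
      ext t
      constructor
      · rintro ⟨p', q', hne', hp', hq', ht⟩
        rcases (key p').1 hp' with rfl | rfl <;> rcases (key q').1 hq' with rfl | rfl
        · exact absurd rfl hne'
        · exact ht
        · rwa [cyclicOrder_swap] at ht
        · exact absurd rfl hne'
      · intro ht
        exact ⟨p, q, hne, (key p).2 (Or.inl rfl), (key q).2 (Or.inr rfl), ht⟩
    · rw [wordVert_eq_inr, Set.ncard_singleton] at h
      omega
  connected := by
    have step : ∀ i : Fin (N + 1), (SimpleGraph.fromRel fun u v => ∃ h : Fin (N + 1) × Bool,
        wordVert w h = u ∧ wordVert w (h.1, !h.2) = v).Reachable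
          (wordVert w (i, false)) (wordVert w (i, true)) := by
      intro i
      by_cases h : wordVert w (i, false) = wordVert w (i, true)
      · rw [h]
      · exact SimpleGraph.Adj.reachable
          ((SimpleGraph.fromRel_adj _ _ _).2 ⟨h, Or.inl ⟨(i, false), rfl, rfl⟩⟩)
    have first : ∀ i : Fin (N + 1), (SimpleGraph.fromRel fun u v => ∃ h : Fin (N + 1) × Bool,
        wordVert w h = u ∧ wordVert w (h.1, !h.2) = v).Reachable
          (Sum.inr false) (wordVert w (i, false)) := by
      intro i
      induction i using Fin.induction with
      | zero => exact SimpleGraph.Reachable.refl _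
      | succ i ih =>
        have h : wordVert w (i.castSucc, true) = wordVert w (i.succ, false) := by simp [wordVert]
        exact h ▸ ih.trans (step _)
    have all : ∀ v, (SimpleGraph.fromRel fun u v => ∃ h : Fin (N + 1) × Bool,
        wordVert w h = u ∧ wordVert w (h.1, !h.2) = v).Reachable (Sum.inr false) v := by
      rintro (a | b)
      · obtain ⟨p, q, -, hpq⟩ := Set.ncard_eq_two.1 (hw a)
        have hp : w p = a := by
          have : p ∈ {i | w i = a} := by simp [hpq]
          exact this
        simpa [wordVert, hp] using first p.succ
      · cases b
        · exact SimpleGraph.Reachable.refl _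
        · simpa [wordVert] using (first (Fin.last N)).trans (step (Fin.last N))
    exact ⟨fun u v => (all u).symm.trans (all v)⟩

/-- The graph of a double occurrence word is simple: the path through its edges `0, …, N` is a
transverse path visiting each edge exactly once. -/
theorem isSimple_ofWord (w : Fin N → A) (hw : IsDoubleOccurrence w) : (ofWord w hw).IsSimple := by
  have hN : ∀ b : Bool, (ofWord w hw).degree (Sum.inr b) = 1 := fun b => by
    change {h | wordVert w h = Sum.inr b}.ncard = 1
    rw [wordVert_eq_inr, Set.ncard_singleton]
  have hs : ∀ i : Fin N, wordVert w (i.castSucc, true) = wordVert w (i.succ, false) := fun i => by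
    simp [wordVert]
  have get : ∀ i (hi : i < (List.ofFn fun i : Fin (N + 1) => (i, false)).length),
      (List.ofFn fun i : Fin (N + 1) => (i, false))[i] = (⟨i, by simpa using hi⟩, false) := by
    intro i hi
    rw [List.getElem_ofFn]
  refine ⟨⟨Sum.inr false, List.ofFn fun i => (i, false), ?_, ?_⟩, ⟨hN _, ?_, ?_, ?_⟩, ?_⟩
  · intro h hh
    simp [List.ofFn_succ] at hh
    rw [← hh]
    rfl
  · rw [List.isChain_iff_getElem]
    intro i hi
    rw [get, get]
    exact hs ⟨i, by simpa using hi⟩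
  · have : ∀ h h', (⟨Sum.inr false, List.ofFn fun i => (i, false), h, h'⟩ :
        (ofWord w hw).Path).finish = Sum.inr true := by
      intro h h'
      simp only [Path.finish, Path.support]
      rw [List.getLast_cons (by simp), List.getLast_map (by simp), List.getLast_ofFn_succ]
      simp [ofWord, wordVert]
    rw [this]
    exact hN _
  · simp only [Path.edges]
    rw [List.nodup_map_iff_inj_on (List.nodup_ofFn.2 fun i j h => by simpa using h)]
    intro x hx y hy h
    simp only [List.mem_ofFn] at hx hy
    obtain ⟨i, rfl⟩ := hx
    obtain ⟨j, rfl⟩ := hy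
    simpa [edge, ofWord] using h
  · simp only
    rw [List.isChain_iff_getElem]
    intro i hi
    rw [get, get]
    rintro ⟨a | b, t, ht, h0, h1⟩
    · obtain ⟨p, q, hne, -, -, ht⟩ := ht
      have e : t 0 = ((⟨i, by simp at hi; omega⟩ : Fin N).castSucc, true) := h0
      have e' : t 1 = ((⟨i, by simp at hi; omega⟩ : Fin N).succ, false) := h1
      simp only [cyclicOrder, Set.mem_insert_iff, Set.mem_singleton_iff] at ht
      rcases ht with rfl | rfl | rfl | rfl | rfl | rfl | rfl | rfl <;>
        simp [Fin.ext_iff] at e e' hne <;> omega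
    · exact ht
  · rintro ⟨i, b⟩
    simp only [Path.edges, List.mem_map, List.mem_ofFn]
    refine ⟨_, ⟨i, rfl⟩, ?_⟩
    cases b <;> simp [edge, ofWord, Sym2.eq_swap]

end AssemblyGraph

/-- The word `1 2 1 3 2 4 3 … (n-1) (n-2) n (n-1) n` with its letters renamed to `0, …, n - 1`. With
positions counted from `0`, the letter `k - 1` stands at the position `2 k` for `1 ≤ k < n`, the
letter `k` stands at the position `2 k - 1` for `1 ≤ k < n`, and the two remaining letters are
`0` at the position `0` and `n - 1` at the position `2 n - 1`. -/
def tangledCordWord (n : ℕ) (i : Fin (2 * n)) : Fin n :=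
  ⟨if i.val % 2 = 0 then i.val / 2 - 1 else min ((i.val + 1) / 2) (n - 1), by
    have := i.isLt
    split_ifs <;> omega⟩

theorem tangledCordWord_five : List.ofFn (fun i => (tangledCordWord 5 i).val + 1) =
    [1, 2, 1, 3, 2, 4, 3, 5, 4, 5] := by decide

theorem isDoubleOccurrence_tangledCordWord (n : ℕ) : IsDoubleOccurrence (tangledCordWord n) := by
  intro a
  have ha := a.isLt
  rw [Set.ncard_eq_two]
  refine ⟨⟨2 * a - 1, by omega⟩, ⟨min (2 * a + 2) (2 * n - 1), by omega⟩, ?_, ?_⟩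
  · simp only [ne_eq, Fin.mk.injEq]
    omega
  · ext i
    have := i.isLt
    simp only [Set.mem_ofPred_eq, Set.mem_insert_iff, Set.mem_singleton_iff, tangledCordWord,
      Fin.ext_iff]
    split_ifs <;> omega

/-- The tangled cord of order `n`. -/
def tangledCord (n : ℕ) : AssemblyGraph (Fin n ⊕ Bool) (Fin (2 * n + 1) × Bool) :=
  AssemblyGraph.ofWord (tangledCordWord n) (isDoubleOccurrence_tangledCordWord n)

/-! A Hamiltonian set of polygonal paths is determined by the half-edges on its paths. The sets of
half-edges that arise are the forests (`IsForest`). The neighbour relation at a rigid vertex is a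
4-cycle, which has no triangle, so a forest has at most two half-edges at each vertex and its
components are polygonal paths (`ncard_hamiltonianSets`). A cycle is expressed as a nonempty set of
half-edges, closed under `opp`, in which no half-edge is alone at its vertex; this includes loops
and double edges.

A simple graph with `n` rigid vertices is the graph of a double occurrence word of length `2 * n`
(`IsSimple.exists_iso_ofWord`). Its edges, apart from the first and the last one, join consecutive
positions of the word: they are dominoes on `[0, 2 * n)`. The two half-edges at one position are not
neighbours, while half-edges at the two positions of a letter are. Hence the neighbour condition
says exactly that the dominoes are disjoint, and there are `Nat.fib (2 * n + 1)` sets of disjoint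
dominoes (`card_dominoSets`). Let `τ` exchange the two positions of each letter. A domino set
contains a cycle if and only if some nonempty subset of it covers a `τ`-invariant set of positions.
The domino set that covers everything always does, which gives the bound.

Equality means that no other domino set contains a cycle, in other words that `τ` is rigid: a
nonempty set of disjoint dominoes covering a `τ`-invariant set covers every position
(`isRigidPairing_iff`). Contracting the first or the last domino preserves rigidity
(`IsRigidPairing.contract`), and the two contractions together determine `τ` by induction
(`IsRigidPairing.eq_tangled`). So there is only one rigid pairing. The pairing of the tangled cord
is rigid (`isRigidPairing_tangledCord`), and a pairing determines the graph up to isomorphism. -/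

namespace AssemblyGraph

/-! ### Hamiltonian sets of polygonal paths as forests of half-edges -/

section Forest

variable {V H : Type*} {Γ : AssemblyGraph V H}

theorem exists_enum_of_mem_order {v : V} {t : Fin 4 → H} (ht : t ∈ Γ.order v) :
    ∃ e : Fin 4 → H, Function.Injective e ∧ Set.range e = {h | Γ.vert h = v} ∧
      Γ.order v = cyclicOrder e := by
  rcases Γ.degree_eq v with h | h
  · simp [Γ.order_endpoint v h] at ht
  · exact Γ.order_rigid v h

theorem vert_of_mem_order {v : V} {t : Fin 4 → H} (ht : t ∈ Γ.order v) (i : Fin 4) :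
    Γ.vert (t i) = v := by
  obtain ⟨e, -, hr, ho⟩ := exists_enum_of_mem_order ht
  have h : ∀ j, Γ.vert (e j) = v := fun j => by
    have : e j ∈ Set.range e := ⟨j, rfl⟩
    rwa [hr] at this
  rw [ho] at ht
  simp only [cyclicOrder, Set.mem_insert_iff, Set.mem_singleton_iff] at ht
  rcases ht with rfl | rfl | rfl | rfl | rfl | rfl | rfl | rfl <;> fin_cases i <;> simp [h]

/-- Neighbours are consecutive in every enumeration of the half-edges that gives the cyclic
order. -/
theorem Neighbours.consecutive {v : V} {e : Fin 4 → H} (he : Function.Injective e)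
    (hr : Set.range e = {h | Γ.vert h = v}) (ho : Γ.order v = cyclicOrder e) {i j : Fin 4}
    (h : Γ.Neighbours (e i) (e j)) : j = i + 1 ∨ i = j + 1 := by
  obtain ⟨v', t, ht, h0, h1⟩ := h
  have hv : v' = v := by
    rw [← vert_of_mem_order ht 0, h0]
    have : e i ∈ Set.range e := ⟨i, rfl⟩
    rwa [hr] at this
  subst hv
  rw [ho] at ht
  simp only [cyclicOrder, Set.mem_insert_iff, Set.mem_singleton_iff] at ht
  rcases ht with rfl | rfl | rfl | rfl | rfl | rfl | rfl | rfl <;>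
    simp at h0 h1 <;> rw [← he h0, ← he h1] <;> decide

theorem Neighbours.vert_eq {h h' : H} (hn : Γ.Neighbours h h') : Γ.vert h = Γ.vert h' := by
  obtain ⟨v, t, ht, rfl, rfl⟩ := hn
  rw [vert_of_mem_order ht, vert_of_mem_order ht]

theorem Neighbours.symm {h h' : H} (hn : Γ.Neighbours h h') : Γ.Neighbours h' h := by
  obtain ⟨v, t, ht, rfl, rfl⟩ := hn
  obtain ⟨e, -, -, ho⟩ := exists_enum_of_mem_order ht
  refine ⟨v, ![t 1, t 0, t 3, t 2], ?_, rfl, rfl⟩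
  rw [ho] at ht ⊢
  simp only [cyclicOrder, Set.mem_insert_iff, Set.mem_singleton_iff] at ht ⊢
  rcases ht with rfl | rfl | rfl | rfl | rfl | rfl | rfl | rfl <;> simp

/-- The neighbour relation at a rigid vertex is a 4-cycle, which has no triangle. This is what
limits a forest to two half-edges per vertex. -/
theorem not_neighbours_triangle {a b c : H} (hab : Γ.Neighbours a b) (hbc : Γ.Neighbours b c)
    (hac : Γ.Neighbours a c) : False := by
  obtain ⟨v, t, ht, h0, h1⟩ := id hab
  have ha : Γ.vert a = v := h0 ▸ vert_of_mem_order ht 0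
  obtain ⟨e, he, hr, ho⟩ := exists_enum_of_mem_order ht
  have mem : ∀ h, Γ.vert h = v → ∃ i, e i = h := fun h hh => by
    have : h ∈ {h | Γ.vert h = v} := hh
    rwa [← hr] at this
  obtain ⟨i, rfl⟩ := mem a ha
  obtain ⟨j, rfl⟩ := mem b (hab.vert_eq ▸ ha)
  obtain ⟨k, rfl⟩ := mem c (hac.vert_eq ▸ ha)
  have h1 := hab.consecutive he hr ho
  have h2 := hbc.consecutive he hr ho
  have h3 := hac.consecutive he hr ho
  have key : ∀ i j k : Fin 4, (j = i + 1 ∨ i = j + 1) → (k = j + 1 ∨ j = k + 1) →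
      (k = i + 1 ∨ i = k + 1) → False := by decide
  exact key i j k h1 h2 h3

theorem edge_opp (h : H) : Γ.edge (Γ.opp h) = Γ.edge h := by
  simp [edge, Γ.opp_opp, Sym2.eq_swap]

theorem edge_eq_iff {h h' : H} : Γ.edge h = Γ.edge h' ↔ h = h' ∨ h = Γ.opp h' := by
  simp only [edge, Sym2.eq_iff]
  constructor
  · rintro (⟨h1, -⟩ | ⟨h1, -⟩)
    · exact Or.inl h1
    · exact Or.inr h1
  · rintro (rfl | rfl)
    · exact Or.inl ⟨rfl, rfl⟩
    · exact Or.inr ⟨rfl, Γ.opp_opp _⟩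

namespace Path

theorem mem_edges {p : Γ.Path} {h : H} :
    Γ.edge h ∈ p.edges ↔ ∃ i : ℕ, p.halves[i]? = some h ∨ p.halves[i]? = some (Γ.opp h) := by
  rw [edges, List.mem_map]
  constructor
  · rintro ⟨a, ha, hah⟩
    obtain ⟨i, hi⟩ := List.mem_iff_getElem?.1 ha
    refine ⟨i, ?_⟩
    rcases edge_eq_iff.1 hah with rfl | rfl
    · exact Or.inl hi
    · exact Or.inr hi
  · rintro ⟨i, hi | hi⟩
    · exact ⟨h, List.mem_of_getElem? hi, rfl⟩
    · exact ⟨_, List.mem_of_getElem? hi, edge_opp h⟩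

theorem support_succ {p : Γ.Path} {i : ℕ} {h : H} (hi : p.halves[i]? = some h) :
    p.support[i + 1]? = some (Γ.vert (Γ.opp h)) := by
  simp [support, hi]

theorem support_getElem {p : Γ.Path} {i : ℕ} {h : H} (hi : p.halves[i]? = some h) :
    p.support[i]? = some (Γ.vert h) := by
  cases i with
  | zero =>
    rw [p.start_eq h (by rw [List.head?_eq_getElem?]; exact hi)]
    simp [support]
  | succ k =>
    obtain ⟨hk, rfl⟩ := List.getElem?_eq_some_iff.1 hi
    rw [support_succ (List.getElem?_eq_getElem (by omega : k < p.halves.length))]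
    rw [(List.isChain_iff_getElem.1 p.chain) k hk]

theorem vert_mem_support {p : Γ.Path} {h : H} (he : Γ.edge h ∈ p.edges) :
    Γ.vert h ∈ p.support := by
  obtain ⟨i, hi | hi⟩ := mem_edges.1 he
  · exact List.mem_of_getElem? (support_getElem hi)
  · have := List.mem_of_getElem? (support_succ hi)
    rwa [Γ.opp_opp] at this

theorem index_unique {p : Γ.Path} (hp : p.support.Nodup) {i j : ℕ} {v : V}
    (hi : p.support[i]? = some v) (hj : p.support[j]? = some v) : i = j := by
  obtain ⟨hi', rfl⟩ := List.getElem?_eq_some_iff.1 hi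
  obtain ⟨hj', h⟩ := List.getElem?_eq_some_iff.1 hj
  exact ((hp.getElem_inj_iff).1 h).symm

/-- The half-edges of a path at its vertex of index `i`. -/
theorem eq_of_mem_edges {p : Γ.Path} (hp : p.support.Nodup) {i : ℕ} {h : H}
    (he : Γ.edge h ∈ p.edges) (hi : p.support[i]? = some (Γ.vert h)) :
    p.halves[i]? = some h ∨ ∃ k, i = k + 1 ∧ p.halves[k]? = some (Γ.opp h) := by
  obtain ⟨j, hj | hj⟩ := mem_edges.1 he
  · rw [index_unique hp hi (support_getElem hj)]
    exact Or.inl hj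
  · have := support_succ hj
    rw [Γ.opp_opp] at this
    exact Or.inr ⟨j, index_unique hp hi this, hj⟩

theorem not_backtrack {p : Γ.Path} (hp : p.support.Nodup) {i : ℕ} {h : H}
    (h0 : p.halves[i]? = some (Γ.opp h)) (h1 : p.halves[i + 1]? = some h) : False := by
  have := index_unique hp (support_getElem h0) (support_succ h1)
  omega

theorem edges_reverse (p : Γ.Path) {h : H} : Γ.edge h ∈ p.reverse.edges ↔ Γ.edge h ∈ p.edges := by
  simp only [edges, reverse, List.map_reverse, List.map_map, List.mem_reverse, List.mem_map,
    Function.comp_apply, edge_opp]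

theorem start_mem (p : Γ.Path) : p.start ∈ p.support := by simp [support]

theorem IsPolygonal.reverse {p : Γ.Path} (hp : p.IsPolygonal) : p.reverse.IsPolygonal := by
  refine ⟨?_, ?_, ?_⟩
  · rw [support_reverse, List.nodup_reverse]
    exact hp.1
  · intro v hv
    exact hp.2.1 v ((p.mem_support_reverse v).1 hv)
  · simp only [Path.reverse]
    rw [List.isChain_reverse, List.isChain_map]
    refine hp.2.2.imp fun a b hab => ?_
    simp only [Γ.opp_opp]
    exact hab.symm

/-- A path that is a connected component of a set `T` of half-edges. -/
structure IsComponent (T : Set H) (p : Γ.Path) : Prop where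
  isPolygonal : p.IsPolygonal
  mem : ∀ h, Γ.edge h ∈ p.edges → h ∈ T
  mem_edges : ∀ h ∈ T, Γ.vert h ∈ p.support → Γ.edge h ∈ p.edges

theorem IsComponent.reverse {T : Set H} {p : Γ.Path} (hp : p.IsComponent T) :
    p.reverse.IsComponent T where
  isPolygonal := hp.isPolygonal.reverse
  mem h hh := hp.mem h (p.edges_reverse.1 hh)
  mem_edges h hh hv := p.edges_reverse.2 (hp.mem_edges h hh ((p.mem_support_reverse _).1 hv))

/-- The next half-edge of `p` lies in `T` at a vertex of `q`, so its edge is on `q`. There it is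
either the next half-edge of `q` or the reverse of the previous one, and in the latter case `p`
would backtrack. -/
theorem IsComponent.halves_step {T : Set H} {p q : Γ.Path} (hp : p.IsComponent T)
    (hq : q.IsComponent T) (hs : p.start = q.start) {i : ℕ} {h : H}
    (ih : ∀ j < i, p.halves[j]? = q.halves[j]?) (hi : p.halves[i]? = some h) :
    q.halves[i]? = some h := by
  have hv : q.support[i]? = some (Γ.vert h) := by
    rw [← support_getElem hi]
    cases i with
    | zero => simp [support, hs]
    | succ k => simp [support, ih k (by omega)]
  have he := hq.mem_edges h (hp.mem h (Path.mem_edges.2 ⟨i, Or.inl hi⟩)) (List.mem_of_getElem? hv)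
  rcases eq_of_mem_edges hq.isPolygonal.1 he hv with h1 | ⟨k, rfl, hk⟩
  · exact h1
  · rw [← ih k (by omega)] at hk
    exact (not_backtrack hp.isPolygonal.1 hk hi).elim

theorem IsComponent.eq_of_start_eq {T : Set H} {p q : Γ.Path} (hp : p.IsComponent T)
    (hq : q.IsComponent T) (hs : p.start = q.start) : p = q := by
  ext1
  · exact hs
  · apply List.ext_getElem?
    intro i
    induction i using Nat.strong_induction_on with
    | _ i ih =>
      apply Option.ext
      intro h
      exact ⟨hp.halves_step hq hs ih, hq.halves_step hp hs.symm fun j hj => (ih j hj).symm⟩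

/-- Walking backwards along `p` from a common vertex never leaves `q`, since each edge of `p` met at
a vertex of `q` is an edge of `q`. -/
theorem IsComponent.start_mem_support {T : Set H} {p q : Γ.Path} (hp : p.IsComponent T)
    (hq : q.IsComponent T) {v : V} (hvp : v ∈ p.support) (hvq : v ∈ q.support) :
    p.start ∈ q.support := by
  obtain ⟨i, hi⟩ := List.mem_iff_getElem?.1 hvp
  induction i generalizing v with
  | zero =>
    simp [support] at hi
    rwa [hi]
  | succ k ih =>
    obtain ⟨h, hk, rfl⟩ : ∃ h, p.halves[k]? = some h ∧ Γ.vert (Γ.opp h) = v := by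
      simpa [support] using hi
    have h1 : Γ.opp h ∈ T := hp.mem _ (by
      rw [edge_opp]
      exact Path.mem_edges.2 ⟨k, Or.inl hk⟩)
    have h2 := hq.mem_edges _ h1 hvq
    rw [edge_opp] at h2
    have h3 := support_getElem hk
    exact ih (List.mem_of_getElem? h3) (vert_mem_support h2) h3

theorem finish_eq {p : Γ.Path} : p.support[p.halves.length]? = some p.finish := by
  unfold finish
  simp only [List.getElem?_eq_some_iff, support]
  refine ⟨by simp, ?_⟩
  rw [List.getLast_eq_getElem]
  simp

theorem IsComponent.eq_or_eq_reverse {T : Set H} {p q : Γ.Path} (hp : p.IsComponent T)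
    (hq : q.IsComponent T) {v : V} (hvp : v ∈ p.support) (hvq : v ∈ q.support) :
    p = q ∨ p = q.reverse := by
  obtain ⟨j, hj⟩ := List.mem_iff_getElem?.1 (hp.start_mem_support hq hvp hvq)
  have hlen : j < q.support.length := (List.getElem?_eq_some_iff.1 hj).1
  have hlen' : j ≤ q.halves.length := by
    simp [support] at hlen
    omega
  rcases Nat.eq_zero_or_pos j with rfl | hpos
  · left
    refine hp.eq_of_start_eq hq ?_
    simp [support] at hj
    exact hj.symm
  rcases hlen'.eq_or_lt with rfl | hlt
  · right
    refine hp.eq_of_start_eq hq.reverse ?_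
    rw [finish_eq] at hj
    exact (Option.some_inj.1 hj).symm
  -- If the start of `p` were an inner vertex of `q`, both edges of `q` there would be edges of `p`.
  -- But `p` has only one half-edge at its start, so `q` would backtrack.
  exfalso
  obtain ⟨k, rfl⟩ : ∃ k, j = k + 1 := ⟨j - 1, by omega⟩
  have ha := List.getElem?_eq_getElem (by omega : k < q.halves.length)
  have hb := List.getElem?_eq_getElem hlt
  set a := q.halves[k]
  set b := q.halves[k + 1]
  have hva : p.support[0]? = some (Γ.vert (Γ.opp a)) := by
    rw [← support_succ ha, hj]
    simp [support]
  have hvb : p.support[0]? = some (Γ.vert b) := by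
    rw [← support_getElem hb, hj]
    simp [support]
  have hTa : Γ.edge (Γ.opp a) ∈ p.edges := by
    refine hp.mem_edges _ (hq.mem _ ?_) (List.mem_of_getElem? hva)
    rw [edge_opp]
    exact Path.mem_edges.2 ⟨k, Or.inl ha⟩
  have hTb : Γ.edge b ∈ p.edges :=
    hp.mem_edges _ (hq.mem _ (Path.mem_edges.2 ⟨k + 1, Or.inl hb⟩)) (List.mem_of_getElem? hvb)
  have h1 : p.halves[0]? = some (Γ.opp a) := by
    simpa using eq_of_mem_edges hp.isPolygonal.1 hTa hva
  have h2 : p.halves[0]? = some b := by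
    simpa using eq_of_mem_edges hp.isPolygonal.1 hTb hvb
  have h3 : Γ.opp a = b := by simpa [h1] using h2
  refine not_backtrack hq.isPolygonal.1 (h := b) ?_ hb
  rw [ha, ← h3, Γ.opp_opp]

end Path

variable (Γ) in
/-- The sets of half-edges that are covered by Hamiltonian sets of polygonal paths. -/
structure IsForest (T : Set H) : Prop where
  opp_mem : ∀ h ∈ T, Γ.opp h ∈ T
  degree_eq_four : ∀ h ∈ T, Γ.degree (Γ.vert h) = 4
  neighbours : ∀ h ∈ T, ∀ h' ∈ T, Γ.vert h = Γ.vert h' → h ≠ h' → Γ.Neighbours h h'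
  acyclic : ∀ T' ⊆ T, (∀ h ∈ T', Γ.opp h ∈ T') →
    (∀ h ∈ T', ∃ h' ∈ T', h' ≠ h ∧ Γ.vert h' = Γ.vert h) → T' = ∅

theorem IsForest.eq_or_eq_or_eq {T : Set H} (hT : Γ.IsForest T) {a b c : H} (ha : a ∈ T)
    (hb : b ∈ T) (hc : c ∈ T) (hab : Γ.vert a = Γ.vert b) (hac : Γ.vert a = Γ.vert c) :
    a = b ∨ a = c ∨ b = c := by
  by_contra! h
  exact not_neighbours_triangle (hT.neighbours a ha b hb hab h.1)
    (hT.neighbours b hb c hc (hab.symm.trans hac) h.2.2) (hT.neighbours a ha c hc hac h.2.1)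

/-- The half-edges on a path. -/
def Path.halfSet (p : Γ.Path) : Set H := {h | Γ.edge h ∈ p.edges}

/-- A path inside a forest can be prolonged at its start along every half-edge of the forest that
is not on the path. -/
theorem IsForest.exists_cons {T : Set H} (hT : Γ.IsForest T) {p : Γ.Path} (hp : p.IsPolygonal)
    (hpT : p.halfSet ⊆ T) {h : H} (hh : h ∈ T) (hs : Γ.vert h = p.start)
    (hn : Γ.edge h ∉ p.edges) :
    ∃ q : Γ.Path, q.IsPolygonal ∧ q.halfSet ⊆ T ∧ q.support = Γ.vert (Γ.opp h) :: p.support := by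
  have hoT := hT.opp_mem h hh
  have hno : Γ.edge (Γ.opp h) ∉ p.edges := by rwa [edge_opp]
  have ne_of : ∀ {a b : H}, Γ.edge a ∈ p.edges → Γ.edge b ∉ p.edges → b ≠ a := by
    rintro a b h1 h2 rfl
    exact h2 h1
  have hnot : Γ.vert (Γ.opp h) ∉ p.support := by
    intro hmem
    -- If the new edge returned to `p`, then it would close a cycle with `p`.
    have key : ({h, Γ.opp h} ∪ p.halfSet : Set H) = ∅ := by
      apply hT.acyclic
      · rintro x ((rfl | rfl) | hx)
        exacts [hh, hoT, hpT hx]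
      · rintro x ((rfl | rfl) | hx)
        · simp
        · simp [Γ.opp_opp]
        · right
          simpa [Path.halfSet, edge_opp] using hx
      · obtain ⟨j, hj⟩ := List.mem_iff_getElem?.1 hmem
        have mem_of : ∀ {i : ℕ} {a : H}, p.halves[i]? = some a →
            Γ.edge a ∈ p.edges ∧ Γ.edge (Γ.opp a) ∈ p.edges := fun {i a} ha => by
          rw [edge_opp]
          exact ⟨Path.mem_edges.2 ⟨i, Or.inl ha⟩, Path.mem_edges.2 ⟨i, Or.inl ha⟩⟩
        have pred : ∀ {k : ℕ} {v : V}, p.support[k + 1]? = some v →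
            ∃ a, p.halves[k]? = some a ∧ Γ.vert (Γ.opp a) = v := fun {k v} hk => by
          simpa [Path.support] using hk
        have start_eq : p.support[0]? = some p.start := by simp [Path.support]
        -- The new edge can return only to the last vertex of `p`: at any other vertex it would
        -- create three half-edges of the forest or a backtracking of `p`.
        have hlast : p.halves[j]? = none := by
          by_contra hne
          obtain ⟨b, hb⟩ := Option.ne_none_iff_exists'.1 hne
          have hvb : Γ.vert (Γ.opp h) = Γ.vert b := by
            have := Path.support_getElem hb
            rw [hj] at this
            exact Option.some_inj.1 this
          have hbe := (mem_of hb).1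
          cases j with
          | zero =>
            have hvh : Γ.vert (Γ.opp h) = Γ.vert h := by
              rw [start_eq] at hj
              rw [hs]
              exact (Option.some_inj.1 hj).symm
            rcases hT.eq_or_eq_or_eq hoT (hpT hbe) hh hvb hvh with h1 | h1 | h1
            · exact ne_of hbe hno h1
            · exact Γ.opp_ne h h1
            · exact ne_of hbe hn h1.symm
          | succ k =>
            obtain ⟨a, ha, hva⟩ := pred hj
            have hae := (mem_of ha).2
            rcases hT.eq_or_eq_or_eq hoT (hpT hbe) (hpT hae) hvb hva.symm with h1 | h1 | h1
            · exact ne_of hbe hno h1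
            · exact ne_of hae hno h1
            · refine Path.not_backtrack hp.1 (h := b) ?_ hb
              rw [ha, h1, Γ.opp_opp]
        -- The companion of a half-edge at its vertex is on the next or previous edge of the closed
        -- walk. The separate cases are the two places where the new edge is attached, which
        -- coincide if `p` has no edges.
        rintro x ((rfl | rfl) | hx)
        · rcases hp0 : p.halves[0]? with _ | a
          · refine ⟨Γ.opp x, by simp, Γ.opp_ne x, ?_⟩
            have hj0 : j = 0 := by
              have h1 := (List.getElem?_eq_some_iff.1 hj).1
              have h2 := List.getElem?_eq_none_iff.1 hp0
              simp only [Path.support, List.length_cons, List.length_map] at h1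
              omega
            rw [hj0, start_eq] at hj
            rw [hs]
            exact (Option.some_inj.1 hj).symm
          · refine ⟨a, Or.inr (mem_of hp0).1, (ne_of (mem_of hp0).1 hn).symm, ?_⟩
            rw [hs, p.start_eq a (by rw [List.head?_eq_getElem?]; exact hp0)]
        · cases j with
          | zero =>
            refine ⟨h, by simp, (Γ.opp_ne h).symm, ?_⟩
            rw [start_eq] at hj
            rw [hs]
            exact Option.some_inj.1 hj
          | succ k =>
            obtain ⟨a, ha, hva⟩ := pred hj
            exact ⟨Γ.opp a, Or.inr (mem_of ha).2, (ne_of (mem_of ha).2 hno).symm, hva⟩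
        · obtain ⟨i, hi⟩ := List.mem_iff_getElem?.1 (Path.vert_mem_support hx)
          cases i with
          | zero =>
            refine ⟨h, by simp, ne_of hx hn, ?_⟩
            rw [start_eq] at hi
            rw [hs]
            exact Option.some_inj.1 hi
          | succ k =>
            rcases Path.eq_of_mem_edges hp.1 hx hi with h1 | ⟨k', hk, h1⟩
            · obtain ⟨a, ha, hva⟩ := pred hi
              refine ⟨Γ.opp a, Or.inr (mem_of ha).2, ?_, hva⟩
              intro hax
              refine Path.not_backtrack hp.1 (h := x) ?_ h1
              rw [ha, ← hax, Γ.opp_opp]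
            · obtain rfl : k = k' := by omega
              rcases hp1 : p.halves[k + 1]? with _ | b
              · refine ⟨Γ.opp h, by simp, ne_of hx hno, ?_⟩
                have hjk : j = k + 1 := by
                  have h2 := (List.getElem?_eq_some_iff.1 hj).1
                  have h3 := (List.getElem?_eq_some_iff.1 hi).1
                  have h4 := List.getElem?_eq_none_iff.1 hp1
                  have h5 := List.getElem?_eq_none_iff.1 hlast
                  simp only [Path.support, List.length_cons, List.length_map] at h2 h3
                  omega
                rw [hjk, hi] at hj
                exact (Option.some_inj.1 hj).symm
              · refine ⟨b, Or.inr (mem_of hp1).1, ?_, ?_⟩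
                · rintro rfl
                  exact Path.not_backtrack hp.1 h1 hp1
                · have := Path.support_getElem hp1
                  rw [hi] at this
                  exact (Option.some_inj.1 this).symm
    have : h ∈ ({h, Γ.opp h} ∪ p.halfSet : Set H) := by simp
    simp [key] at this
  refine ⟨⟨Γ.vert (Γ.opp h), Γ.opp h :: p.halves, ?_, ?_⟩, ⟨?_, ?_, ?_⟩, ?_, ?_⟩
  · simp
  · rw [List.isChain_cons]
    refine ⟨fun y hy => ?_, p.chain⟩
    rw [Γ.opp_opp, hs, p.start_eq y hy]
  · simp only [Path.support, List.map_cons, Γ.opp_opp, hs]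
    exact List.nodup_cons.2 ⟨hnot, hp.1⟩
  · intro v hv
    simp only [Path.support, List.map_cons, Γ.opp_opp, hs] at hv
    rcases List.mem_cons.1 hv with rfl | hv
    · exact hT.degree_eq_four _ hoT
    · exact hp.2.1 v hv
  · rw [List.isChain_cons]
    refine ⟨fun y hy => ?_, hp.2.2⟩
    have hy' : Γ.edge y ∈ p.edges :=
      Path.mem_edges.2 ⟨0, Or.inl (by rw [← List.head?_eq_getElem?]; exact hy)⟩
    rw [Γ.opp_opp]
    exact hT.neighbours _ hh _ (hpT hy') (by rw [hs, p.start_eq y hy]) (ne_of hy' hn)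
  · intro x hx
    simp only [Path.halfSet, Path.edges, List.map_cons, List.mem_cons, Set.mem_ofPred_eq] at hx
    rcases hx with hx | hx
    · rcases edge_eq_iff.1 hx with rfl | rfl
      · exact hoT
      · rwa [Γ.opp_opp]
    · exact hpT hx
  · simp [Path.support, Γ.opp_opp, hs]

theorem Path.halfSet_reverse (p : Γ.Path) : p.reverse.halfSet = p.halfSet := by
  ext h
  exact p.edges_reverse

/-- A half-edge of `T` that is at a vertex of `p` but not on `p` must be at one of the ends, as an
inner vertex already has its two half-edges. At the far end, the reverse of `p` is prolonged. -/
theorem IsForest.exists_longer {T : Set H} (hT : Γ.IsForest T) {p : Γ.Path} (hp : p.IsPolygonal)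
    (hpT : p.halfSet ⊆ T) (hc : ¬ p.IsComponent T) :
    ∃ q : Γ.Path, q.IsPolygonal ∧ q.halfSet ⊆ T ∧ (∀ v ∈ p.support, v ∈ q.support) ∧
      q.support.length = p.support.length + 1 := by
  obtain ⟨h, hh, hv, hn⟩ : ∃ h ∈ T, Γ.vert h ∈ p.support ∧ Γ.edge h ∉ p.edges := by
    by_contra! hcon
    exact hc ⟨hp, fun h hh => hpT hh, hcon⟩
  obtain ⟨i, hi⟩ := List.mem_iff_getElem?.1 hv
  have hlen : i ≤ p.halves.length := by
    have := (List.getElem?_eq_some_iff.1 hi).1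
    simp [Path.support] at this
    omega
  rcases Nat.eq_zero_or_pos i with rfl | hpos
  · obtain ⟨q, h1, h2, h3⟩ := hT.exists_cons hp hpT hh (by simpa [Path.support] using hi.symm) hn
    exact ⟨q, h1, h2, by simp +contextual [h3], by simp [h3]⟩
  rcases hlen.eq_or_lt with rfl | hlt
  · rw [Path.finish_eq] at hi
    obtain ⟨q, h1, h2, h3⟩ := hT.exists_cons hp.reverse (by rwa [Path.halfSet_reverse]) hh
      (Option.some_inj.1 hi).symm (fun he => hn (p.edges_reverse.1 he))
    refine ⟨q, h1, h2, ?_, ?_⟩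
    · simp +contextual [h3, Path.support_reverse]
    · simp [h3, Path.support_reverse]
  exfalso
  obtain ⟨k, rfl⟩ : ∃ k, i = k + 1 := ⟨i - 1, by omega⟩
  have ha := List.getElem?_eq_getElem (by omega : k < p.halves.length)
  have hb := List.getElem?_eq_getElem hlt
  set a := p.halves[k]
  set b := p.halves[k + 1]
  have hae : Γ.edge (Γ.opp a) ∈ p.edges := by
    rw [edge_opp]
    exact Path.mem_edges.2 ⟨k, Or.inl ha⟩
  have hbe : Γ.edge b ∈ p.edges := Path.mem_edges.2 ⟨k + 1, Or.inl hb⟩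
  have hva : Γ.vert h = Γ.vert (Γ.opp a) := by
    have := Path.support_succ ha
    rw [hi] at this
    exact Option.some_inj.1 this
  have hvb : Γ.vert h = Γ.vert b := by
    have := Path.support_getElem hb
    rw [hi] at this
    exact Option.some_inj.1 this
  rcases hT.eq_or_eq_or_eq hh (hpT hae) (hpT hbe) hva hvb with h1 | h1 | h1
  · exact hn (h1 ▸ hae)
  · exact hn (h1 ▸ hbe)
  · refine Path.not_backtrack hp.1 (h := b) ?_ hb
    rw [ha, ← h1, Γ.opp_opp]

/-- Starting from the singleton path at `v`, prolonging must stop, because the vertices of a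
polygonal path are distinct. -/
theorem IsForest.exists_component [Finite V] {T : Set H} (hT : Γ.IsForest T) {v : V}
    (hv : Γ.degree v = 4) : ∃ p : Γ.Path, p.IsComponent T ∧ v ∈ p.support := by
  by_contra! hcon
  have key : ∀ n : ℕ, ∃ p : Γ.Path, p.IsPolygonal ∧ p.halfSet ⊆ T ∧ v ∈ p.support ∧
      n < p.support.length := by
    intro n
    induction n with
    | zero =>
      refine ⟨⟨v, [], by simp, by simp⟩, ⟨by simp [Path.support], ?_, by simp⟩, ?_, ?_, ?_⟩
      · simp [Path.support, hv]
      · intro h hh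
        simp [Path.halfSet, Path.edges] at hh
      · simp [Path.support]
      · simp [Path.support]
    | succ n ih =>
      obtain ⟨p, hp, hpT, hvp, hlen⟩ := ih
      obtain ⟨q, h1, h2, h3, h4⟩ := hT.exists_longer hp hpT fun hc => hcon p hc hvp
      exact ⟨q, h1, h2, h3 v hvp, by omega⟩
  have := Fintype.ofFinite V
  obtain ⟨p, hp, -, -, hlen⟩ := key (Fintype.card V)
  exact absurd hp.1.length_le_card (by omega)

/-- The half-edges on the paths of a set of polygonal paths. -/
def halfSetOf (S : Set Γ.PolygonalPath) : Set H :=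
  {h | ∃ p : {p : Γ.Path // p.IsPolygonal},
    Quotient.mk Γ.polygonalSetoid p ∈ S ∧ Γ.edge h ∈ p.1.edges}

/-- The set of components of a set of half-edges. -/
def componentsOf (T : Set H) : Set Γ.PolygonalPath :=
  {P | ∃ (p : Γ.Path) (hp : p.IsComponent T),
    Quotient.mk Γ.polygonalSetoid ⟨p, hp.isPolygonal⟩ = P}

/-- Members of a vertex-disjoint family sharing a vertex are equal. -/
theorem mk_eq_of_mem {S : Set Γ.PolygonalPath} (hS : S ∈ Γ.hamiltonianSets)
    {p q : {p : Γ.Path // p.IsPolygonal}} (hp : Quotient.mk Γ.polygonalSetoid p ∈ S)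
    (hq : Quotient.mk Γ.polygonalSetoid q ∈ S) {v : V} (hvp : v ∈ p.1.support)
    (hvq : v ∈ q.1.support) :
    Quotient.mk Γ.polygonalSetoid p = Quotient.mk Γ.polygonalSetoid q := by
  by_contra hne
  exact Set.disjoint_left.1 (hS.1 hp hq hne) (show v ∈ {v | v ∈ p.1.support} from hvp) hvq

theorem isComponent_of_mem {S : Set Γ.PolygonalPath} (hS : S ∈ Γ.hamiltonianSets)
    {p : {p : Γ.Path // p.IsPolygonal}} (hp : Quotient.mk Γ.polygonalSetoid p ∈ S) :
    p.1.IsComponent (halfSetOf S) where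
  isPolygonal := p.2
  mem h hh := ⟨p, hp, hh⟩
  mem_edges := by
    rintro h ⟨q, hq, hhq⟩ hv
    have := mk_eq_of_mem hS hp hq hv (Path.vert_mem_support hhq)
    rcases Quotient.exact this with h1 | h1
    · rwa [h1]
    · rw [h1]
      exact (Path.edges_reverse _).2 hhq

theorem exists_mk_mem {S : Set Γ.PolygonalPath} (hS : S ∈ Γ.hamiltonianSets) {v : V}
    (hv : Γ.degree v = 4) : ∃ p : {p : Γ.Path // p.IsPolygonal},
      Quotient.mk Γ.polygonalSetoid p ∈ S ∧ v ∈ p.1.support := by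
  obtain ⟨P, hP, hvP⟩ := hS.2 v hv
  obtain ⟨p, rfl⟩ := Quotient.exists_rep P
  exact ⟨p, hP, hvP⟩

theorem isForest_halfSetOf {S : Set Γ.PolygonalPath} (hS : S ∈ Γ.hamiltonianSets) :
    Γ.IsForest (halfSetOf S) where
  opp_mem := by
    rintro h ⟨p, hp, hh⟩
    exact ⟨p, hp, by rwa [edge_opp]⟩
  degree_eq_four := by
    rintro h ⟨p, hp, hh⟩
    exact p.2.2.1 _ (Path.vert_mem_support hh)
  neighbours := by
    rintro h ⟨p, hp, hh⟩ h' hh' hv hne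
    have hh1 := (isComponent_of_mem hS hp).mem_edges h' hh' (hv ▸ Path.vert_mem_support hh)
    obtain ⟨i, hi⟩ := List.mem_iff_getElem?.1 (Path.vert_mem_support hh)
    have hi' := hi
    rw [hv] at hi'
    have step : ∀ {k : ℕ} {a b : H}, p.1.halves[k]? = some (Γ.opp a) →
        p.1.halves[k + 1]? = some b → Γ.Neighbours a b := by
      intro k a b ha hb
      obtain ⟨hk, hb⟩ := List.getElem?_eq_some_iff.1 hb
      obtain ⟨hk', ha⟩ := List.getElem?_eq_some_iff.1 ha
      have := List.isChain_iff_getElem.1 p.2.2.2 k hk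
      rwa [ha, hb, Γ.opp_opp] at this
    rcases Path.eq_of_mem_edges p.2.1 hh hi with h1 | ⟨k, rfl, h1⟩ <;>
      rcases Path.eq_of_mem_edges p.2.1 hh1 hi' with h2 | ⟨k', hk, h2⟩
    · rw [h1] at h2
      exact absurd (Option.some_inj.1 h2) hne
    · subst hk
      exact (step h2 h1).symm
    · exact step h1 h2
    · obtain rfl : k = k' := by omega
      rw [h1] at h2
      have := congrArg Γ.opp (Option.some_inj.1 h2)
      rw [Γ.opp_opp, Γ.opp_opp] at this
      exact absurd this hne
  acyclic := by
    intro T' hT' hopp hcyc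
    by_contra hne
    obtain ⟨h, hh⟩ := Set.nonempty_iff_ne_empty.2 hne
    obtain ⟨p, hp, hhp⟩ := hT' hh
    -- Consider the first edge of the path `p` with its half-edges in `T'`. Any companion of its
    -- first half would have to be on the preceding edge, which is not in `T'`.
    have hex : ∃ i : ℕ, ∃ a ∈ T', p.1.halves[i]? = some a := by
      obtain ⟨i, hi | hi⟩ := Path.mem_edges.1 hhp
      · exact ⟨i, _, hh, hi⟩
      · exact ⟨i, _, hopp _ hh, hi⟩
    classical
    obtain ⟨a, ha, hi⟩ := Nat.find_spec hex
    have hmin := fun {m} => Nat.find_min hex (m := m)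
    set i := Nat.find hex
    obtain ⟨b, hb, hba, hv⟩ := hcyc a ha
    have hs := Path.support_getElem hi
    rw [← hv] at hs
    have hbe := (isComponent_of_mem hS hp).mem_edges b (hT' hb) (List.mem_of_getElem? hs)
    rcases Path.eq_of_mem_edges p.2.1 hbe hs with h1 | ⟨k, hk, h1⟩
    · rw [hi] at h1
      exact hba (Option.some_inj.1 h1).symm
    · exact hmin (by omega : k < i) ⟨_, hopp b hb, h1⟩

theorem mk_eq_of_isComponent {T : Set H} {p q : {p : Γ.Path // p.IsPolygonal}}
    (hp : p.1.IsComponent T) (hq : q.1.IsComponent T) {v : V} (hvp : v ∈ p.1.support)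
    (hvq : v ∈ q.1.support) :
    Quotient.mk Γ.polygonalSetoid p = Quotient.mk Γ.polygonalSetoid q :=
  Quotient.sound ((hp.eq_or_eq_reverse hq hvp hvq).imp_left fun h => Subtype.ext h)

theorem componentsOf_halfSetOf {S : Set Γ.PolygonalPath} (hS : S ∈ Γ.hamiltonianSets) :
    componentsOf (halfSetOf S) = S := by
  ext P
  constructor
  · rintro ⟨p, hp, rfl⟩
    obtain ⟨q, hq, hvq⟩ := exists_mk_mem hS (hp.isPolygonal.2.1 _ p.start_mem)
    rwa [mk_eq_of_isComponent (p := ⟨p, hp.isPolygonal⟩) hp (isComponent_of_mem hS hq)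
      p.start_mem hvq]
  · intro hP
    obtain ⟨p, rfl⟩ := Quotient.exists_rep P
    exact ⟨p.1, isComponent_of_mem hS hP, rfl⟩

theorem componentsOf_mem [Finite V] {T : Set H} (hT : Γ.IsForest T) :
    componentsOf T ∈ Γ.hamiltonianSets := by
  constructor
  · rintro P ⟨p, hp, rfl⟩ Q ⟨q, hq, rfl⟩ hne
    refine Set.disjoint_left.2 fun v hvp hvq => hne ?_
    exact mk_eq_of_isComponent (p := ⟨p, hp.isPolygonal⟩) (q := ⟨q, hq.isPolygonal⟩) hp hq hvp hvq
  · intro v hv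
    obtain ⟨p, hp, hvp⟩ := hT.exists_component hv
    exact ⟨_, ⟨p, hp, rfl⟩, hvp⟩

theorem halfSetOf_componentsOf [Finite V] {T : Set H} (hT : Γ.IsForest T) :
    halfSetOf (Γ := Γ) (componentsOf T) = T := by
  ext h
  constructor
  · rintro ⟨q, ⟨p, hp, hpq⟩, hh⟩
    rcases Quotient.exact hpq with h1 | h1
    · exact hp.mem h (by rwa [← h1] at hh)
    · refine hp.mem h ?_
      change p = _ at h1
      rw [h1]
      exact (Path.edges_reverse _).2 hh
  · intro hh
    obtain ⟨p, hp, hvp⟩ := hT.exists_component (hT.degree_eq_four h hh)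
    exact ⟨⟨p, hp.isPolygonal⟩, ⟨p, hp, rfl⟩, hp.mem_edges h hh hvp⟩

/-- Hamiltonian sets of polygonal paths correspond to forests. -/
theorem ncard_hamiltonianSets [Finite V] :
    Γ.hamiltonianSets.ncard = {T | Γ.IsForest T}.ncard := by
  refine Set.ncard_congr (fun S _ => halfSetOf S) (fun S hS => isForest_halfSetOf hS) ?_ ?_
  · intro S S' hS hS' h
    rw [← componentsOf_halfSetOf hS, ← componentsOf_halfSetOf hS']
    exact congrArg componentsOf h
  · intro T hT
    exact ⟨componentsOf T, componentsOf_mem hT, halfSetOf_componentsOf hT⟩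

end Forest

end AssemblyGraph

/-! ### Cyclic orders, isomorphisms, and simple graphs as graphs of words -/

theorem cyclicOrder_comp_mem_iff {H H' : Type*} {φ : H → H'} (hφ : Function.Injective φ)
    (e t : Fin 4 → H) :
    (fun i => φ (t i)) ∈ cyclicOrder (fun i => φ (e i)) ↔ t ∈ cyclicOrder e := by
  have key : ∀ a b c d : H, (fun i => φ (t i)) = ![φ a, φ b, φ c, φ d] ↔ t = ![a, b, c, d] := by
    intro a b c d
    simp [funext_iff, Fin.forall_fin_succ, hφ.eq_iff]
  simp only [cyclicOrder, Set.mem_insert_iff, Set.mem_singleton_iff, key]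

/-- A cyclic order of four elements, up to rotation and reversal, is determined by which element is
opposite to a given one. -/
theorem cyclicOrder_comp_of_opposite {H : Type*} (e : Fin 4 → H) {π : Fin 4 → Fin 4}
    (hπ : Function.Injective π) (h : ¬ (π 2 = π 0 + 1 ∨ π 0 = π 2 + 1)) :
    cyclicOrder (fun i => e (π i)) = cyclicOrder e := by
  have key : ∀ a b c d : Fin 4, a ≠ b → a ≠ c → a ≠ d → b ≠ c → b ≠ d → c ≠ d →
      ¬ (c = a + 1 ∨ a = c + 1) → ((b = a + 1 ∧ c = a + 2 ∧ d = a + 3) ∨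
        (b = a + 3 ∧ c = a + 2 ∧ d = a + 1)) := by decide
  have ne : ∀ i j, i ≠ j → π i ≠ π j := fun i j hij h => hij (hπ h)
  have := key (π 0) (π 1) (π 2) (π 3) (ne _ _ (by decide)) (ne _ _ (by decide))
    (ne _ _ (by decide)) (ne _ _ (by decide)) (ne _ _ (by decide)) (ne _ _ (by decide)) h
  ext t
  simp only [cyclicOrder, Set.mem_insert_iff, Set.mem_singleton_iff]
  generalize π 0 = a at *
  rcases this with ⟨h1, h2, h3⟩ | ⟨h1, h2, h3⟩ <;> rw [h1, h2, h3] <;> fin_cases a <;>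
    simp <;> tauto

theorem IsDoubleOccurrence.surjective {A : Type*} {N : ℕ} {w : Fin N → A}
    (hw : IsDoubleOccurrence w) : Function.Surjective w := by
  intro a
  have : {i | w i = a}.Nonempty := Set.nonempty_of_ncard_ne_zero (by rw [hw a]; omega)
  exact this

namespace AssemblyGraph

section Iso

variable {V H V' H' : Type*} {Γ : AssemblyGraph V H} {Γ' : AssemblyGraph V' H'}

theorem degree_of_mem_order {v : V} {t : Fin 4 → H} (ht : t ∈ Γ.order v) : Γ.degree v = 4 := by
  rcases Γ.degree_eq v with h | h
  · simp [Γ.order_endpoint v h] at ht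
  · exact h

theorem eq_of_degree_eq_one {a b : H} (h : Γ.degree (Γ.vert a) = 1)
    (hb : Γ.vert b = Γ.vert a) : a = b := by
  obtain ⟨c, hc⟩ := Set.ncard_eq_one.1 h
  have ha : a ∈ {h | Γ.vert h = Γ.vert a} := rfl
  have hb : b ∈ {h | Γ.vert h = Γ.vert a} := hb
  rw [hc] at ha hb
  exact ha.trans hb.symm

namespace Iso

theorem degree_eq (e : Γ.Iso Γ') (v : V) : Γ'.degree (e.onVert v) = Γ.degree v := by
  have : {h | Γ'.vert h = e.onVert v} = e.onHalf '' {h | Γ.vert h = v} := by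
    ext h
    obtain ⟨h, rfl⟩ := e.onHalf.surjective h
    simp [e.vert_comm]
  rw [degree, this, Set.ncard_image_of_injective _ e.onHalf.injective, degree]

/-- The inverse of an isomorphism. -/
def symm (e : Γ.Iso Γ') : Γ'.Iso Γ where
  onVert := e.onVert.symm
  onHalf := e.onHalf.symm
  vert_comm h := by
    obtain ⟨h, rfl⟩ := e.onHalf.surjective h
    simp [e.vert_comm]
  opp_comm h := by
    obtain ⟨h, rfl⟩ := e.onHalf.surjective h
    simp [e.opp_comm]
  order_comm v hv t := by
    obtain ⟨v, rfl⟩ := e.onVert.surjective v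
    rw [e.degree_eq] at hv
    rw [Equiv.symm_apply_apply, ← e.order_comm v hv]
    simp

/-- The composition of isomorphisms. -/
def trans {V'' H'' : Type*} {Γ'' : AssemblyGraph V'' H''} (e : Γ.Iso Γ') (e' : Γ'.Iso Γ'') :
    Γ.Iso Γ'' where
  onVert := e.onVert.trans e'.onVert
  onHalf := e.onHalf.trans e'.onHalf
  vert_comm h := by simp [e.vert_comm, e'.vert_comm]
  opp_comm h := by simp [e.opp_comm, e'.opp_comm]
  order_comm v hv t := by
    rw [← e.order_comm v hv, ← e'.order_comm _ ((e.degree_eq v).trans hv)]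
    rfl

theorem neighbours (e : Γ.Iso Γ') {a b : H} (h : Γ.Neighbours a b) :
    Γ'.Neighbours (e.onHalf a) (e.onHalf b) := by
  obtain ⟨v, t, ht, rfl, rfl⟩ := h
  exact ⟨_, _, (e.order_comm v (degree_of_mem_order ht) t).2 ht, rfl, rfl⟩

theorem isForest_preimage (e : Γ.Iso Γ') {T : Set H'} (hT : Γ'.IsForest T) :
    Γ.IsForest (e.onHalf ⁻¹' T) where
  opp_mem h hh := by
    rw [Set.mem_preimage, ← e.opp_comm]
    exact hT.opp_mem _ hh
  degree_eq_four h hh := by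
    rw [← e.degree_eq, ← e.vert_comm]
    exact hT.degree_eq_four _ hh
  neighbours h hh h' hh' hv hne := by
    have := e.symm.neighbours (hT.neighbours _ hh _ hh' (by rw [e.vert_comm, e.vert_comm, hv])
      (e.onHalf.injective.ne hne))
    simpa [symm] using this
  acyclic T' hT' hopp hcyc := by
    rw [← Set.image_eq_empty (f := e.onHalf)]
    apply hT.acyclic
    · rintro _ ⟨h, hh, rfl⟩
      exact hT' hh
    · rintro _ ⟨h, hh, rfl⟩
      exact ⟨_, hopp h hh, (e.opp_comm h).symm⟩
    · rintro _ ⟨h, hh, rfl⟩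
      obtain ⟨h', hh', hne, hv⟩ := hcyc h hh
      exact ⟨_, ⟨h', hh', rfl⟩, e.onHalf.injective.ne hne, by rw [e.vert_comm, e.vert_comm, hv]⟩

theorem ncard_isForest (e : Γ.Iso Γ') : {T | Γ'.IsForest T}.ncard = {T | Γ.IsForest T}.ncard := by
  refine Set.ncard_congr (fun T _ => e.onHalf ⁻¹' T) (fun T hT => e.isForest_preimage hT) ?_ ?_
  · intro T T' _ _ h
    exact e.onHalf.surjective.preimage_injective h
  · intro T hT
    refine ⟨_, e.symm.isForest_preimage hT, ?_⟩
    ext h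
    simp [symm]

end Iso

theorem neighbours_of_consecutive {v : V} {e : Fin 4 → H} (ho : Γ.order v = cyclicOrder e)
    {i j : Fin 4} (h : j = i + 1 ∨ i = j + 1) : Γ.Neighbours (e i) (e j) := by
  have key : ∀ i : Fin 4, Γ.Neighbours (e i) (e (i + 1)) := by
    intro i
    refine ⟨v, ![e i, e (i + 1), e (i + 2), e (i + 3)], ?_, rfl, rfl⟩
    rw [ho]
    fin_cases i <;> simp [cyclicOrder]
  rcases h with rfl | rfl
  · exact key i
  · exact (key j).symm

/-- An enumeration of the half-edges at a rigid vertex whose entries `0` and `2` are not neighbours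
determines the cyclic order. -/
theorem order_eq_cyclicOrder {v : V} (hv : Γ.degree v = 4) {f : Fin 4 → H}
    (hf : Function.Injective f) (hr : Set.range f = {h | Γ.vert h = v})
    (hn : ¬ Γ.Neighbours (f 0) (f 2)) : Γ.order v = cyclicOrder f := by
  obtain ⟨e, he, her, ho⟩ := Γ.order_rigid v hv
  have : ∀ i, ∃ j, e j = f i := fun i => by
    have : f i ∈ Set.range f := ⟨i, rfl⟩
    rwa [hr, ← her] at this
  choose π hπ using this
  have hf' : f = fun i => e (π i) := funext fun i => (hπ i).symm
  subst hf'
  rw [ho, cyclicOrder_comp_of_opposite e (fun i j h => hf (congrArg e h))]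
  intro h
  exact hn (neighbours_of_consecutive ho h)

theorem wordOrder_inl {A : Type*} {N : ℕ} (w : Fin N → A) {a : A} {p q : Fin N} (hne : p ≠ q)
    (hpq : {i | w i = a} = {p, q}) : wordOrder w (Sum.inl a) =
      cyclicOrder ![(p.castSucc, true), (q.castSucc, true), (p.succ, false), (q.succ, false)] := by
  have key : ∀ i, w i = a ↔ i = p ∨ i = q := fun i => by
    simpa using congrArg (i ∈ ·) hpq
  ext t
  constructor
  · rintro ⟨p', q', hne', hp', hq', ht⟩
    rcases (key p').1 hp' with rfl | rfl <;> rcases (key q').1 hq' with rfl | rfl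
    · exact absurd rfl hne'
    · exact ht
    · rwa [cyclicOrder_swap] at ht
    · exact absurd rfl hne'
  · intro ht
    exact ⟨p, q, hne, (key p).2 (Or.inl rfl), (key q).2 (Or.inr rfl), ht⟩

/-- The half-edge number `x` along a sequence of edges `g`. -/
def halfAlong (Γ : AssemblyGraph V H) {N : ℕ} (g : Fin (N + 1) → H) : Fin (N + 1) × Bool → H
  | (i, false) => g i
  | (i, true) => Γ.opp (g i)

/-- A graph traversed transversely by the sequence of edges `g` is the graph of a word. -/
theorem exists_iso_ofWord_of_traversal {N : ℕ} {g : Fin (N + 1) → H}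
    (hinj : ∀ i j, Γ.edge (g i) = Γ.edge (g j) → i = j)
    (hcov : ∀ h, ∃ i, h = g i ∨ h = Γ.opp (g i))
    (hchain : ∀ i : Fin N, Γ.vert (Γ.opp (g i.castSucc)) = Γ.vert (g i.succ))
    (htr : ∀ i : Fin N, ¬ Γ.Neighbours (Γ.opp (g i.castSucc)) (g i.succ))
    (hs : Γ.degree (Γ.vert (g 0)) = 1) (hf : Γ.degree (Γ.vert (Γ.opp (g (Fin.last N)))) = 1) :
    ∃ (w : Fin N → {v // Γ.degree v = 4}) (hw : IsDoubleOccurrence w),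
      Nonempty (Γ.Iso (ofWord w hw)) := by
  have φinj : Function.Injective (Γ.halfAlong g) := by
    rintro ⟨i, b⟩ ⟨j, c⟩ h
    have hij : i = j := hinj i j (by
      cases b <;> cases c <;> simp only [halfAlong] at h
      · rw [h]
      · rw [h, edge_opp]
      · rw [← h, edge_opp]
      · rw [← edge_opp, h, edge_opp])
    subst hij
    cases b <;> cases c <;> simp only [halfAlong] at h
    · rfl
    · exact absurd h.symm (Γ.opp_ne _)
    · exact absurd h (Γ.opp_ne _)
    · rfl
  have φsurj : Function.Surjective (Γ.halfAlong g) := by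
    intro h
    obtain ⟨i, rfl | rfl⟩ := hcov h
    · exact ⟨(i, false), rfl⟩
    · exact ⟨(i, true), rfl⟩
  -- At a vertex of degree `1` the arriving and the leaving half-edge would coincide, and two
  -- consecutive edges of the traversal would be the same.
  have hdeg : ∀ i : Fin N, Γ.degree (Γ.vert (g i.succ)) = 4 := by
    intro i
    refine (Γ.degree_eq _).resolve_left fun h1 => ?_
    have := eq_of_degree_eq_one h1 (hchain i)
    have := hinj _ _ (this ▸ edge_opp _)
    simp [Fin.ext_iff] at this
  set w : Fin N → {v // Γ.degree v = 4} := fun i => ⟨_, hdeg i⟩ with hwdef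
  let ψ : {v // Γ.degree v = 4} ⊕ Bool → V := Sum.elim Subtype.val fun b =>
    if b then Γ.vert (Γ.opp (g (Fin.last N))) else Γ.vert (g 0)
  have hvert : ∀ x, Γ.vert (Γ.halfAlong g x) = ψ (wordVert w x) := by
    rintro ⟨i, b⟩
    cases b
    · refine Fin.cases ?_ (fun j => ?_) i <;> simp [halfAlong, wordVert, ψ, hwdef]
    · refine Fin.lastCases ?_ (fun j => ?_) i <;> simp [halfAlong, wordVert, ψ, hwdef, hchain]
  have hends : Γ.vert (g 0) ≠ Γ.vert (Γ.opp (g (Fin.last N))) := by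
    intro h
    have h1 := eq_of_degree_eq_one hs h.symm
    have h2 := @φinj (0, false) (Fin.last N, true) h1
    simp at h2
  have ψinj : Function.Injective ψ := by
    rintro (⟨a, ha⟩ | b) (⟨a', ha'⟩ | b') h
    · simp only [ψ, Sum.elim_inl] at h
      subst h
      rfl
    · exfalso
      simp only [ψ, Sum.elim_inl, Sum.elim_inr] at h
      rw [h] at ha
      split_ifs at ha <;> omega
    · exfalso
      simp only [ψ, Sum.elim_inl, Sum.elim_inr] at h
      rw [← h] at ha'
      split_ifs at ha' <;> omega
    · cases b <;> cases b' <;> simp [ψ, hends, hends.symm] at h ⊢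
  have ψsurj : Function.Surjective ψ := by
    intro v
    have : ∃ h, Γ.vert h = v := by
      have : {h | Γ.vert h = v}.Nonempty := by
        apply Set.nonempty_of_ncard_ne_zero
        rcases Γ.degree_eq v with h | h <;> omega
      exact this
    obtain ⟨h, rfl⟩ := this
    obtain ⟨x, rfl⟩ := φsurj h
    exact ⟨_, (hvert x).symm⟩
  -- Each visit to a rigid vertex uses one arriving and one leaving half-edge, so its four
  -- half-edges make two visits.
  have hw : IsDoubleOccurrence w := by
    intro a
    have h4 : {h | Γ.vert h = a.1}.ncard = 4 := a.2
    let κ : Fin N × Bool → H := fun x =>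
      Γ.halfAlong g (if x.2 then (x.1.castSucc, true) else (x.1.succ, false))
    have κinj : Function.Injective κ := by
      rintro ⟨i, b⟩ ⟨j, c⟩ h
      have := φinj h
      cases b <;> cases c <;> simp at this ⊢ <;> exact this
    have : {h | Γ.vert h = a.1} = κ '' ({i | w i = a} ×ˢ Set.univ) := by
      ext h
      obtain ⟨⟨i, b⟩, rfl⟩ := φsurj h
      simp only [Set.mem_ofPred_eq, Set.mem_image, Set.mem_prod, Set.mem_univ, and_true]
      rw [hvert]
      change _ = ψ (Sum.inl a) ↔ _
      rw [ψinj.eq_iff]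
      constructor
      · intro hx
        cases b
        · revert hx
          refine Fin.cases ?_ (fun j => ?_) i
          · simp [wordVert]
          · intro hx
            exact ⟨(j, false), by simpa [wordVert] using hx, rfl⟩
        · revert hx
          refine Fin.lastCases ?_ (fun j => ?_) i
          · simp [wordVert]
          · intro hx
            exact ⟨(j, true), by simpa [wordVert] using hx, rfl⟩
      · rintro ⟨⟨j, c⟩, hj, hx⟩
        rw [← φinj hx]
        cases c <;> simpa [wordVert] using hj
    rw [this, Set.ncard_image_of_injective _ κinj, Set.ncard_prod] at h4
    simp at h4
    omega
  refine ⟨w, hw, ⟨Iso.symm ⟨Equiv.ofBijective ψ ⟨ψinj, ψsurj⟩,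
    Equiv.ofBijective _ ⟨φinj, φsurj⟩, hvert, ?_, ?_⟩⟩⟩
  · rintro ⟨i, b⟩
    cases b
    · rfl
    · exact Γ.opp_opp _
  · rintro (a | b) hv t
    · obtain ⟨p, q, hne, hpq⟩ := Set.ncard_eq_two.1 (hw a)
      change (fun i => Γ.halfAlong g (t i)) ∈ Γ.order a.1 ↔ t ∈ wordOrder w (Sum.inl a)
      rw [wordOrder_inl w hne hpq, ← cyclicOrder_comp_mem_iff φinj, ← order_eq_cyclicOrder a.2]
      · exact φinj.comp (injective_word hne)
      · change Set.range (Γ.halfAlong g ∘ _) = _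
        rw [Set.range_comp, ← wordVert_eq_inl w a hpq]
        ext h
        obtain ⟨x, rfl⟩ := φsurj h
        rw [φinj.mem_set_image, Set.mem_ofPred_eq, Set.mem_ofPred_eq, hvert]
        exact ψinj.eq_iff.symm
      · exact htr p
    · have : {h | wordVert w h = Sum.inr b}.ncard = 4 := hv
      rw [wordVert_eq_inr, Set.ncard_singleton] at this
      omega

/-- Every simple assembly graph is the graph of a double occurrence word. -/
theorem IsSimple.exists_iso_ofWord (hΓ : Γ.IsSimple) :
    ∃ (N : ℕ) (w : Fin N → {v // Γ.degree v = 4}) (hw : IsDoubleOccurrence w),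
      Nonempty (Γ.Iso (ofWord w hw)) := by
  obtain ⟨p, ⟨hs, hf, hnd, htr⟩, hcov⟩ := hΓ
  have hlen : p.halves.length ≠ 0 := by
    intro h0
    obtain ⟨h, -⟩ := Set.ncard_eq_one.1 hs
    obtain ⟨i, hi⟩ := Path.mem_edges.1 (hcov h)
    simp [List.length_eq_zero_iff.1 h0] at hi
  obtain ⟨N, hN⟩ := Nat.exists_eq_succ_of_ne_zero hlen
  have lt : ∀ i : Fin (N + 1), i.val < p.halves.length := fun i => by omega
  refine ⟨N, exists_iso_ofWord_of_traversal (g := fun i => p.halves[i.val]'(lt i))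
    ?_ ?_ ?_ ?_ ?_ ?_⟩
  · intro i j h
    have h1 : p.edges[i.val]'(by simp [Path.edges, lt]) =
        p.edges[j.val]'(by simp [Path.edges, lt]) := by simpa [Path.edges] using h
    exact Fin.ext ((hnd.getElem_inj_iff).1 h1)
  · intro h
    obtain ⟨i, hi⟩ := Path.mem_edges.1 (hcov h)
    have hiN : i < N + 1 := by
      rcases hi with hi | hi <;>
      · have := (List.getElem?_eq_some_iff.1 hi).1
        omega
    refine ⟨⟨i, hiN⟩, ?_⟩
    rcases hi with hi | hi
    · exact Or.inl (List.getElem?_eq_some_iff.1 hi).2.symm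
    · right
      rw [(List.getElem?_eq_some_iff.1 hi).2, Γ.opp_opp]
  · intro i
    exact List.isChain_iff_getElem.1 p.chain i.val (by omega)
  · intro i
    exact List.isChain_iff_getElem.1 htr i.val (by omega)
  · have := p.start_eq p.halves[0] (by rw [List.head?_eq_getElem?]; simp)
    rw [← this] at hs
    exact hs
  · have h1 := Path.support_succ (p := p) (List.getElem?_eq_getElem (lt (Fin.last N)))
    have h2 := p.finish_eq
    rw [hN] at h2
    simp only [Fin.val_last] at h1
    rw [h1] at h2
    rw [← Option.some_inj.1 h2] at hf
    exact hf

/-- Words with the same positions of equal letters have isomorphic graphs. -/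
theorem nonempty_iso_ofWord {A A' : Type*} {N : ℕ} {w : Fin N → A} {w' : Fin N → A'}
    (hw : IsDoubleOccurrence w) (hw' : IsDoubleOccurrence w')
    (h : ∀ i j, w i = w j ↔ w' i = w' j) : Nonempty ((ofWord w hw).Iso (ofWord w' hw')) := by
  choose s hs using hw.surjective
  have hsw : ∀ i, w' (s (w i)) = w' i := fun i => (h _ _).1 (hs _)
  let f : A ≃ A' := Equiv.ofBijective (fun a => w' (s a)) ⟨fun a b hab => by
    rw [← hs a, ← hs b]
    exact (h _ _).2 hab, fun b => by
    obtain ⟨i, rfl⟩ := hw'.surjective b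
    exact ⟨w i, hsw i⟩⟩
  have hf : ∀ i, f (w i) = w' i := hsw
  refine ⟨⟨f.sumCongr (Equiv.refl _), Equiv.refl _, ?_, fun _ => rfl, ?_⟩⟩
  · rintro ⟨i, b⟩
    cases b
    · refine Fin.cases ?_ (fun j => ?_) i <;> simp [ofWord, wordVert, hf]
    · refine Fin.lastCases ?_ (fun j => ?_) i <;> simp [ofWord, wordVert, hf]
  · rintro (a | b) - t
    · change (∃ p q : Fin N, p ≠ q ∧ w' p = f a ∧ w' q = f a ∧ _) ↔
        (∃ p q : Fin N, p ≠ q ∧ w p = a ∧ w q = a ∧ _)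
      simp only [← hf, f.injective.eq_iff]
      rfl
    · exact Iff.rfl

end Iso

end AssemblyGraph

/-! ### Rigid pairings and their uniqueness -/

section Domino

/-- The position `i` is covered by a set of dominoes; `M j` means that the domino with the positions
`j` and `j + 1` is present. -/
def DominoCovers (M : ℕ → Prop) (i : ℕ) : Prop := M i ∨ M (i - 1)

/-- A set of pairwise disjoint dominoes in the window `[2 * a, 2 * b)` such that the set of covered
positions is invariant under `τ`. -/
structure IsInvariantDominoSet (a b : ℕ) (τ : ℕ → ℕ) (M : ℕ → Prop) : Prop where
  bounds : ∀ i, M i → 2 * a ≤ i ∧ i + 1 < 2 * b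
  disjoint : ∀ i, M i → ¬ M (i + 1)
  invariant : ∀ i, DominoCovers M i → DominoCovers M (τ i)

/-- A fixed-point-free involution `τ` of the window `[2 * a, 2 * b)` for which nonempty invariant
sets of dominoes cover everything. -/
structure IsRigidPairing (a b : ℕ) (τ : ℕ → ℕ) : Prop where
  mem : ∀ i, 2 * a ≤ i → i < 2 * b → 2 * a ≤ τ i ∧ τ i < 2 * b
  invol : ∀ i, 2 * a ≤ i → i < 2 * b → τ (τ i) = i
  ne : ∀ i, 2 * a ≤ i → i < 2 * b → τ i ≠ i
  full : ∀ M, IsInvariantDominoSet a b τ M → (∃ i, M i) →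
    ∀ i, 2 * a ≤ i → i < 2 * b → DominoCovers M i

/-- The pairing obtained from `τ` by contracting the domino with the positions `d` and `d + 1`. -/
def contractPairing (τ : ℕ → ℕ) (d i : ℕ) : ℕ :=
  if τ i = d then τ (d + 1) else if τ i = d + 1 then τ d else τ i

theorem contractPairing_eq_iff {τ : ℕ → ℕ} {d i j : ℕ} : contractPairing τ d i = j ↔
    (τ i = d ∧ τ (d + 1) = j) ∨ (τ i = d + 1 ∧ τ d = j) ∨ (τ i ≠ d ∧ τ i ≠ d + 1 ∧ τ i = j) := by
  unfold contractPairing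
  split_ifs <;> omega

namespace IsRigidPairing

variable {a b : ℕ} {τ : ℕ → ℕ}

/-- Adjacent partners form an invariant set covered by a single domino, a loop of the graph. One
domino cannot cover both `2 * a` and `2 * a + 2`. -/
theorem not_singleton (h : IsRigidPairing a b τ) (hab : a + 2 ≤ b) {i : ℕ} (h1 : 2 * a ≤ i)
    (h2 : i + 1 < 2 * b) : τ i ≠ i + 1 := by
  intro hi
  have hi' : τ (i + 1) = i := by rw [← hi, h.invol i h1 (by omega)]
  have := h.full (fun j => j = i) ⟨by omega, by omega, fun j hj => by
    have : j = i ∨ j = i + 1 := by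
      unfold DominoCovers at hj
      omega
    unfold DominoCovers
    rcases this with rfl | rfl <;> omega⟩ ⟨i, rfl⟩
  unfold DominoCovers at this
  have h3 := this (2 * a) (by omega) (by omega)
  have h4 := this (2 * a + 2) (by omega) (by omega)
  omega

/-- Two dominoes exchanged by `τ` form an invariant set, a cycle with two edges. They cannot cover
all of `2 * a`, `2 * a + 2` and `2 * a + 4`. -/
theorem not_pair (h : IsRigidPairing a b τ) (hab : a + 3 ≤ b) {i j : ℕ} (h1 : 2 * a ≤ i)
    (hij : i + 2 ≤ j) (h2 : j + 1 < 2 * b)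
    (hτ : (τ i = j ∧ τ (i + 1) = j + 1) ∨ (τ i = j + 1 ∧ τ (i + 1) = j)) : False := by
  have e1 := h.invol i h1 (by omega)
  have e2 := h.invol (i + 1) (by omega) (by omega)
  have := h.full (fun k => k = i ∨ k = j) ⟨by omega, by omega, fun k hk => by
    have : k = i ∨ k = i + 1 ∨ k = j ∨ k = j + 1 := by
      unfold DominoCovers at hk
      omega
    unfold DominoCovers
    rcases hτ with ⟨h3, h4⟩ | ⟨h3, h4⟩ <;> rw [h3] at e1 <;> rw [h4] at e2 <;>
      rcases this with rfl | rfl | rfl | rfl <;> omega⟩ ⟨i, Or.inl rfl⟩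
  unfold DominoCovers at this
  have h3 := this (2 * a) (by omega) (by omega)
  have h4 := this (2 * a + 2) (by omega) (by omega)
  have h5 := this (2 * a + 4) (by omega) (by omega)
  omega

/-- The first or the last domino of the window can be contracted. -/
theorem contract (h : IsRigidPairing a b τ) {a' b' d : ℕ} (hab : a' < b')
    (hd : (a' = a ∧ b = b' + 1 ∧ d = 2 * b') ∨ (a' = a + 1 ∧ b' = b ∧ d = 2 * a)) :
    IsRigidPairing a' b' (contractPairing τ d) := by
  have hx := h.not_singleton (by omega) (i := d) (by omega) (by omega)
  have mx := h.mem d (by omega) (by omega)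
  have my := h.mem (d + 1) (by omega) (by omega)
  have nx := h.ne d (by omega) (by omega)
  have ny := h.ne (d + 1) (by omega) (by omega)
  have ix := h.invol d (by omega) (by omega)
  have iy := h.invol (d + 1) (by omega) (by omega)
  have hy : τ (d + 1) ≠ d := by
    intro hy
    rw [hy] at iy
    omega
  have hxy : τ d ≠ τ (d + 1) := by
    intro e
    rw [e, iy] at ix
    omega
  have hout : ∀ i, 2 * a' ≤ i → i < 2 * b' → i ≠ d ∧ i ≠ d + 1 := by omega
  have back : ∀ i j, 2 * a ≤ i → i < 2 * b → τ i = j → i = τ j := by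
    rintro i j h1 h2 rfl
    exact (h.invol i h1 h2).symm
  have cx : contractPairing τ d (τ d) = τ (d + 1) := contractPairing_eq_iff.2 (Or.inl ⟨ix, rfl⟩)
  have cy : contractPairing τ d (τ (d + 1)) = τ d :=
    contractPairing_eq_iff.2 (Or.inr (Or.inl ⟨iy, rfl⟩))
  have cases' : ∀ i, 2 * a' ≤ i → i < 2 * b' → i = τ d ∨ i = τ (d + 1) ∨
      (τ i ≠ d ∧ τ i ≠ d + 1 ∧ contractPairing τ d i = τ i) := by
    intro i h1 h2
    by_cases e1 : τ i = d
    · exact Or.inl (back i d (by omega) (by omega) e1)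
    by_cases e2 : τ i = d + 1
    · exact Or.inr (Or.inl (back i _ (by omega) (by omega) e2))
    exact Or.inr (Or.inr ⟨e1, e2, contractPairing_eq_iff.2 (Or.inr (Or.inr ⟨e1, e2, rfl⟩))⟩)
  refine ⟨fun i h1 h2 => ?_, fun i h1 h2 => ?_, fun i h1 h2 => ?_, fun M hM hne i h1 h2 => ?_⟩
  · rcases cases' i h1 h2 with rfl | rfl | ⟨e1, e2, e3⟩
    · rw [cx]; omega
    · rw [cy]; omega
    · rw [e3]
      have := h.mem i (by omega) (by omega)
      omega
  · rcases cases' i h1 h2 with rfl | rfl | ⟨e1, e2, e3⟩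
    · rw [cx, cy]
    · rw [cy, cx]
    · rw [e3]
      have e4 := h.invol i (by omega) (by omega)
      have := hout i h1 h2
      exact contractPairing_eq_iff.2 (Or.inr (Or.inr ⟨by omega, by omega, e4⟩))
  · rcases cases' i h1 h2 with rfl | rfl | ⟨e1, e2, e3⟩
    · rw [cx]; omega
    · rw [cy]; omega
    · rw [e3]
      exact h.ne i (by omega) (by omega)
  · have cov_bounds : ∀ j, DominoCovers M j → 2 * a' ≤ j ∧ j < 2 * b' := by
      intro j hj
      rcases hj with hj | hj <;> have := hM.bounds _ hj <;> omega
    have hxy' : DominoCovers M (τ d) ↔ DominoCovers M (τ (d + 1)) := by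
      constructor
      · intro hc
        simpa [cx] using hM.invariant _ hc
      · intro hc
        simpa [cy] using hM.invariant _ hc
    have mono : ∀ j, DominoCovers M j →
        DominoCovers (fun j => M j ∨ (j = d ∧ DominoCovers M (τ d))) j :=
      fun j hj => hj.imp Or.inl Or.inl
    have cd : DominoCovers M (τ d) →
        DominoCovers (fun j => M j ∨ (j = d ∧ DominoCovers M (τ d))) d :=
      fun hc => Or.inl (Or.inr ⟨rfl, hc⟩)
    have cd' : DominoCovers M (τ d) →
        DominoCovers (fun j => M j ∨ (j = d ∧ DominoCovers M (τ d))) (d + 1) :=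
      fun hc => Or.inr (Or.inr ⟨rfl, hc⟩)
    -- An invariant set of the contracted pairing covers both or neither of `τ d` and `τ (d + 1)`.
    -- Adding the domino `d` in the first case makes it invariant under `τ`, and rigidity of `τ`
    -- applies.
    have hfull := h.full (fun j => M j ∨ (j = d ∧ DominoCovers M (τ d))) ⟨?_, ?_, ?_⟩
      (hne.imp fun j hj => Or.inl hj) i (by omega) (by omega)
    · rcases hfull with (h3 | h3) | (h3 | h3)
      · exact Or.inl h3
      · omega
      · exact Or.inr h3
      · omega
    · rintro j (hj | ⟨rfl, -⟩)
      · have := hM.bounds j hj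
        omega
      · omega
    · rintro j (hj | ⟨rfl, -⟩) (hj' | ⟨hj', -⟩)
      · exact hM.disjoint j hj hj'
      · have := hM.bounds j hj
        omega
      · have := hM.bounds _ hj'
        omega
      · omega
    · intro j hj
      by_cases hc : DominoCovers M j
      · obtain ⟨h3, h4⟩ := cov_bounds j hc
        rcases cases' j h3 h4 with rfl | rfl | ⟨e1, e2, e3⟩
        · rw [ix]
          exact cd hc
        · rw [iy]
          exact cd' (hxy'.2 hc)
        · rw [← e3]
          exact mono _ (hM.invariant j hc)
      · rcases hj with (hj | ⟨rfl, hj⟩) | (hj | ⟨hjd, hj⟩)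
        · exact absurd (Or.inl hj) hc
        · exact mono _ hj
        · exact absurd (Or.inr hj) hc
        · rcases Nat.eq_zero_or_pos j with rfl | hpos
          · rw [show 0 = d from hjd]
            exact mono _ hj
          · rw [show j = d + 1 by omega]
            exact mono _ (hxy'.1 hj)

/-- A rigid pairing is the pairing of the tangled cord. -/
theorem eq_tangled (h : IsRigidPairing a b τ) (hab : a + 2 ≤ b) :
    τ (2 * a) = 2 * a + 2 ∧ (∀ k, a ≤ k → k + 3 ≤ b → τ (2 * k + 1) = 2 * k + 4) ∧
      τ (2 * b - 3) = 2 * b - 1 := by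
  obtain ⟨m, rfl⟩ : ∃ m, b = a + 2 + m := ⟨b - (a + 2), by omega⟩
  have back : ∀ {i j}, 2 * a ≤ i → i < 2 * (a + 2 + m) → τ i = j → τ j = i := by
    rintro i j h1 h2 rfl
    exact h.invol i h1 h2
  induction m using Nat.strong_induction_on generalizing a τ with
  | _ m ih =>
  rcases m with _ | _ | m
  · have h0 := h.mem (2 * a) (by omega) (by omega)
    have n0 := h.ne (2 * a) (by omega) (by omega)
    have s0 := h.not_singleton hab (i := 2 * a) (by omega) (by omega)
    have h1 := h.mem (2 * a + 1) (by omega) (by omega)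
    have n1 := h.ne (2 * a + 1) (by omega) (by omega)
    have s1 := h.not_singleton hab (i := 2 * a + 1) (by omega) (by omega)
    have b0 := back (i := 2 * a) (by omega) (by omega) rfl
    have b1 := back (i := 2 * a + 1) (by omega) (by omega) rfl
    have e : 2 * (a + 2 + 0) - 3 = 2 * a + 1 := by omega
    rw [e]
    have h1' : τ (2 * a + 1) ≠ 2 * a := by
      intro e1
      rw [e1] at b1
      omega
    have h1'' : τ (2 * a + 1) = 2 * a + 3 := by omega
    rw [h1''] at b1
    have : τ (2 * a) ≠ 2 * a + 3 := by
      intro e0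
      rw [e0] at b0
      omega
    exact ⟨by omega, by omega, by omega⟩
  -- Three letters: contracting the last domino leaves nine cases. Only the tangled cord survives
  -- the exclusion of adjacent partners and of exchanged dominoes, together with the involution
  -- property.
  · have hL := h.contract (a' := a) (b' := a + 2) (d := 2 * (a + 2)) (by omega) (by omega)
    obtain ⟨l0, -, l1⟩ := ih 0 (by omega) hL (by omega) (fun h1 h2 e => by
      rw [← e]
      exact hL.invol _ h1 (by omega))
    have e1 : 2 * (a + 2 + 0) - 3 = 2 * a + 1 := by omega
    have e2 : 2 * (a + 2 + 0) - 1 = 2 * a + 3 := by omega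
    have e3 : 2 * (a + 2 + (0 + 1)) - 3 = 2 * a + 3 := by omega
    have e4 : 2 * (a + 2 + (0 + 1)) - 1 = 2 * a + 5 := by omega
    have e5 : 2 * (a + 2) = 2 * a + 4 := by omega
    rw [e1, e2, e5, contractPairing_eq_iff] at l1
    rw [e5, contractPairing_eq_iff] at l0
    rw [e3, e4]
    have s0 := h.not_singleton hab (i := 2 * a + 3) (by omega) (by omega)
    have s1 := h.not_singleton hab (i := 2 * a + 4) (by omega) (by omega)
    have p0 := fun h' => h.not_pair (by omega) (i := 2 * a) (j := 2 * a + 3) (by omega) (by omega)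
      (by omega) h'
    have p1 := fun h' => h.not_pair (by omega) (i := 2 * a + 1) (j := 2 * a + 3) (by omega)
      (by omega) (by omega) h'
    have b0 := back (i := 2 * a) (by omega) (by omega) rfl
    have b1 := back (i := 2 * a + 1) (by omega) (by omega) rfl
    have b4 := back (i := 2 * a + 4) (by omega) (by omega) rfl
    have b5 := back (i := 2 * a + 5) (by omega) (by omega) rfl
    have m4 := h.mem (2 * a + 4) (by omega) (by omega)
    have n4 := h.ne (2 * a + 4) (by omega) (by omega)
    have goal : τ (2 * a) = 2 * a + 2 → τ (2 * a + 1) = 2 * a + 4 →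
        τ (2 * a + 3) = 2 * a + 5 → _ := fun g0 g1 g3 =>
      (⟨g0, fun k hk hk' => by
        obtain rfl : k = a := by omega
        exact g1, g3⟩ : τ (2 * a) = 2 * a + 2 ∧
          (∀ k, a ≤ k → k + 3 ≤ a + 2 + (0 + 1) → τ (2 * k + 1) = 2 * k + 4) ∧
          τ (2 * a + 3) = 2 * a + 5)
    have e6 : 2 * a + 4 + 1 = 2 * a + 5 := rfl
    rw [e6] at l0 l1
    rcases l0 with ⟨h1, h2⟩ | ⟨h1, h2⟩ | ⟨h1, h2, h3⟩ <;>
      rcases l1 with ⟨h4, h5⟩ | ⟨h4, h5⟩ | ⟨h4, h5, h6⟩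
    · omega
    · rw [h1] at b0; omega
    · exact (p0 (Or.inr ⟨h1, h6⟩)).elim
    · rw [h1] at b0; omega
    · omega
    · rw [h2] at b4
      exact (p1 (Or.inl ⟨h6, b4⟩)).elim
    · refine goal h3 h4 ?_
      rw [h5] at b5
      exact b5
    · rw [h5] at b4
      exact (s0 b4).elim
    · exfalso
      rw [h3] at b0
      rw [h6] at b1
      have : τ (2 * a + 4) = 2 * a ∨ τ (2 * a + 4) = 2 * a + 1 ∨ τ (2 * a + 4) = 2 * a + 2 ∨
        τ (2 * a + 4) = 2 * a + 3 := by omega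
      rcases this with e | e | e | e <;> rw [e] at b4 <;> omega
  -- Four or more letters: contracting the last domino gives the pairs near the beginning,
  -- contracting the first one gives those near the end. Each contraction rules out the exceptional
  -- cases of the other; this needs `2 * a + 4` to lie before the last domino.
  · have hL := h.contract (a' := a) (b' := a + 2 + (m + 1)) (d := 2 * (a + 2 + (m + 1)))
      (by omega) (by omega)
    have hF := h.contract (a' := a + 1) (b' := a + 1 + 2 + (m + 1)) (d := 2 * a)
      (by omega) (by omega)
    obtain ⟨l0, l1, l2⟩ := ih (m + 1) (by omega) hL (by omega) (fun h1 h2 e => by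
      rw [← e]
      exact hL.invol _ h1 (by omega))
    obtain ⟨f0, f1, f2⟩ := ih (m + 1) (by omega) hF (by omega) (fun h1 h2 e => by
      rw [← e]
      exact hF.invol _ h1 (by omega))
    have l1a := l1 a (by omega) (by omega)
    rw [contractPairing_eq_iff] at l0 l1a f0 f2
    have e1 : 2 * (a + 1 + 2 + (m + 1)) - 3 = 2 * (a + 2 + (m + 2)) - 3 := by omega
    have e2 : 2 * (a + 1) = 2 * a + 2 := by omega
    rw [e1] at f2
    rw [e2] at f0
    have e3 : m + 1 + 1 = m + 2 := rfl
    rw [e3] at back h ⊢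
    set l := 2 * (a + 2 + (m + 1)) with hl
    have e4 : 2 * (a + 2 + (m + 2)) - 3 = l - 1 := by omega
    have e5 : 2 * (a + 2 + (m + 2)) - 1 = l + 1 := by omega
    rw [e4] at f2
    rw [e4, e5]
    have g0 : τ (2 * a) = 2 * a + 2 := by
      rcases l0 with ⟨h1, h2⟩ | ⟨h1, h2⟩ | ⟨h1, h2, h3⟩
      · have := back (by omega) (by omega) h2
        omega
      · have := back (by omega) (by omega) h2
        omega
      · exact h3
    have g2 : τ (l - 1) = l + 1 := by
      rcases f2 with ⟨h1, h2⟩ | ⟨h1, h2⟩ | ⟨h1, h2, h3⟩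
      · have := back (by omega) (by omega) h1
        omega
      · omega
      · omega
    have g2' := back (by omega) (by omega) g2
    refine ⟨g0, fun k hk hk' => ?_, g2⟩
    rcases hk.eq_or_lt with rfl | hlt
    · rcases l1a with ⟨h1, h2⟩ | ⟨h1, h2⟩ | ⟨h1, h2, h3⟩
      · omega
      · have := back (by omega) (by omega) h1
        omega
      · exact h3
    · have f1k := f1 k hlt (by omega)
      rw [contractPairing_eq_iff] at f1k
      rcases f1k with ⟨h1, h2⟩ | ⟨h1, h2⟩ | ⟨h1, h2, h3⟩
      · have := back (by omega) (by omega) h1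
        omega
      · omega
      · exact h3

/-- The pairs found in `eq_tangled` exhaust the window. A window with a single letter has only one
fixed-point-free involution. -/
theorem unique {τ' : ℕ → ℕ} (h : IsRigidPairing a b τ) (h' : IsRigidPairing a b τ') {i : ℕ}
    (h1 : 2 * a ≤ i) (h2 : i < 2 * b) : τ i = τ' i := by
  rcases Nat.lt_or_ge b (a + 2) with hlt | hge
  · have := h.mem i h1 h2
    have := h'.mem i h1 h2
    have := h.ne i h1 h2
    have := h'.ne i h1 h2
    omega
  have key : ∀ j k, 2 * a ≤ j → j < 2 * b → τ j = k → τ' j = k → τ j = τ' j ∧ τ k = τ' k := by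
    intro j k hj hj' e e'
    refine ⟨e.trans e'.symm, ?_⟩
    have i1 := h.invol j hj hj'
    have i2 := h'.invol j hj hj'
    rw [e] at i1
    rw [e'] at i2
    exact i1.trans i2.symm
  obtain ⟨t0, t1, t2⟩ := h.eq_tangled hge
  obtain ⟨t0', t1', t2'⟩ := h'.eq_tangled hge
  have k0 := key _ _ (by omega) (by omega) t0 t0'
  have k2 := key _ _ (by omega) (by omega) t2 t2'
  have k1 := fun k hk hk' => key _ _ (by omega) (by omega) (t1 k hk hk') (t1' k hk hk')
  by_cases c0 : i = 2 * a
  · exact c0 ▸ k0.1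
  by_cases c1 : i = 2 * a + 2
  · exact c1 ▸ k0.2
  by_cases c2 : i = 2 * b - 3
  · exact c2 ▸ k2.1
  by_cases c3 : i = 2 * b - 1
  · exact c3 ▸ k2.2
  rcases Nat.even_or_odd' i with ⟨k, rfl | rfl⟩
  · have := (k1 (k - 2) (by omega) (by omega)).2
    rwa [show 2 * (k - 2) + 4 = 2 * k by omega] at this
  · exact (k1 k (by omega) (by omega)).1

end IsRigidPairing

end Domino

/-! ### Counting sets of disjoint dominoes -/

section Count

/-- The sets of pairwise disjoint dominoes with positions in `[0, m + 1)`. -/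
def dominoSets (m : ℕ) : Finset (Finset ℕ) :=
  (Finset.range m).powerset.filter fun s => ∀ i ∈ s, i + 1 ∉ s

theorem mem_dominoSets {m : ℕ} {s : Finset ℕ} :
    s ∈ dominoSets m ↔ (∀ i ∈ s, i < m) ∧ ∀ i ∈ s, i + 1 ∉ s := by
  simp [dominoSets, Finset.subset_iff]

/-- The Fibonacci recurrence: a domino set either omits the last possible domino, or contains it and
omits the one before. -/
theorem card_dominoSets (m : ℕ) : (dominoSets m).card = Nat.fib (m + 2) := by
  induction m using Nat.twoStepInduction with
  | zero => decide
  | one => decide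
  | more m ih0 ih1 =>
    have hdisj : Disjoint (dominoSets (m + 1)) ((dominoSets m).image (insert (m + 1))) := by
      rw [Finset.disjoint_left]
      intro s hs hs'
      obtain ⟨t, -, rfl⟩ := Finset.mem_image.1 hs'
      have := (mem_dominoSets.1 hs).1 (m + 1) (Finset.mem_insert_self _ _)
      omega
    have hunion : dominoSets (m + 2) =
        dominoSets (m + 1) ∪ (dominoSets m).image (insert (m + 1)) := by
      ext s
      rw [Finset.mem_union, Finset.mem_image]
      constructor
      · intro hs
        obtain ⟨h1, h2⟩ := mem_dominoSets.1 hs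
        by_cases hm : m + 1 ∈ s
        · right
          refine ⟨s.erase (m + 1), mem_dominoSets.2 ⟨fun i hi => ?_, fun i hi hi' => ?_⟩,
            Finset.insert_erase hm⟩
          · obtain ⟨hne, his⟩ := Finset.mem_erase.1 hi
            have := h1 i his
            have : i ≠ m := by
              rintro rfl
              exact h2 i his hm
            omega
          · exact h2 i (Finset.mem_of_mem_erase hi) (Finset.mem_of_mem_erase hi')
        · left
          refine mem_dominoSets.2 ⟨fun i hi => ?_, h2⟩
          have := h1 i hi
          have : i ≠ m + 1 := by
            rintro rfl
            exact hm hi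
          omega
      · rintro (hs | ⟨t, ht, rfl⟩)
        · obtain ⟨h1, h2⟩ := mem_dominoSets.1 hs
          exact mem_dominoSets.2 ⟨fun i hi => by have := h1 i hi; omega, h2⟩
        · obtain ⟨h1, h2⟩ := mem_dominoSets.1 ht
          refine mem_dominoSets.2 ⟨fun i hi => ?_, fun i hi hi' => ?_⟩
          · rcases Finset.mem_insert.1 hi with rfl | hi
            · omega
            · have := h1 i hi
              omega
          · rcases Finset.mem_insert.1 hi with rfl | hi <;>
              rcases Finset.mem_insert.1 hi' with hi' | hi'
            · omega
            · have := h1 _ hi'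
              omega
            · have := h1 _ hi
              omega
            · exact h2 i hi hi'
    rw [hunion, Finset.card_union_of_disjoint hdisj, Finset.card_image_of_injOn, ih0, ih1,
      Nat.fib_add_two (n := m + 2), add_comm]
    intro s hs t ht hst
    have notin : ∀ u ∈ dominoSets m, m + 1 ∉ u := fun u hu hmu => by
      have := (mem_dominoSets.1 hu).1 _ hmu
      omega
    rw [← Finset.erase_insert (notin s hs), ← Finset.erase_insert (notin t ht)]
    exact congrArg (fun u => u.erase (m + 1)) hst

/-- The set of dominoes that covers every position in `[0, 2 * n)`. -/
def perfectDominoSet (n : ℕ) : Finset ℕ := (Finset.range n).image (2 * ·)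

theorem mem_perfectDominoSet {n i : ℕ} : i ∈ perfectDominoSet n ↔ i < 2 * n ∧ i % 2 = 0 := by
  simp only [perfectDominoSet, Finset.mem_image, Finset.mem_range]
  constructor
  · rintro ⟨k, hk, rfl⟩
    omega
  · rintro ⟨h1, h2⟩
    exact ⟨i / 2, by omega, by omega⟩

theorem perfectDominoSet_mem (n : ℕ) : perfectDominoSet n ∈ dominoSets (2 * n - 1) := by
  refine mem_dominoSets.2 ⟨fun i hi => ?_, fun i hi hi' => ?_⟩
  · have := mem_perfectDominoSet.1 hi
    omega
  · have := mem_perfectDominoSet.1 hi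
    have := mem_perfectDominoSet.1 hi'
    omega

theorem perfectDominoSet_covers {n i : ℕ} (hi : i < 2 * n) :
    DominoCovers (· ∈ perfectDominoSet n) i := by
  simp only [DominoCovers, mem_perfectDominoSet]
  omega

/-- Covering from left to right leaves no choice: the domino `2 * k` blocks the next one, so the
position `2 * k + 2` must begin a new domino. -/
theorem eq_perfectDominoSet {n : ℕ} {s : Finset ℕ} (hs : s ∈ dominoSets (2 * n - 1))
    (hc : ∀ i < 2 * n, DominoCovers (· ∈ s) i) : s = perfectDominoSet n := by
  obtain ⟨h1, h2⟩ := mem_dominoSets.1 hs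
  have key : ∀ k < n, 2 * k ∈ s := by
    intro k hk
    induction k with
    | zero => simpa [DominoCovers] using hc 0 (by omega)
    | succ k ih =>
      rcases hc (2 * (k + 1)) (by omega) with h | h
      · exact h
      · exact absurd h (h2 _ (ih (by omega)))
  ext i
  rw [mem_perfectDominoSet]
  constructor
  · intro hi
    have hlt := h1 i hi
    refine ⟨by omega, ?_⟩
    by_contra hodd
    have := key (i / 2) (by omega)
    refine h2 _ this ?_
    rwa [show 2 * (i / 2) + 1 = i by omega]
  · rintro ⟨h3, h4⟩
    have := key (i / 2) (by omega)
    rwa [show 2 * (i / 2) = i by omega] at this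

end Count

/-! ### The pairing of positions of a double occurrence word -/

section Pairing

/-- `τ` exchanges the two occurrences of each letter of `w`. -/
def IsPairingOf {A : Type*} {N : ℕ} (w : Fin N → A) (τ : ℕ → ℕ) : Prop :=
  ∀ (i : ℕ) (hi : i < N), τ i ≠ i ∧ ∃ h : τ i < N, w ⟨τ i, h⟩ = w ⟨i, hi⟩ ∧
    ∀ j, w j = w ⟨i, hi⟩ → j.val = i ∨ j.val = τ i

theorem IsDoubleOccurrence.exists_pairing {A : Type*} {N : ℕ} {w : Fin N → A}
    (hw : IsDoubleOccurrence w) : ∃ τ, IsPairingOf w τ := by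
  have key : ∀ i : ℕ, ∃ k : ℕ, ∀ hi : i < N, k ≠ i ∧ ∃ h : k < N, w ⟨k, h⟩ = w ⟨i, hi⟩ ∧
      ∀ j, w j = w ⟨i, hi⟩ → j.val = i ∨ j.val = k := by
    intro i
    by_cases hi : i < N
    · obtain ⟨p, q, hne, hpq⟩ := Set.ncard_eq_two.1 (hw (w ⟨i, hi⟩))
      have key : ∀ j, w j = w ⟨i, hi⟩ ↔ j = p ∨ j = q := fun j => by
        simpa using congrArg (j ∈ ·) hpq
      rcases (key ⟨i, hi⟩).1 rfl with rfl | rfl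
      · refine ⟨q, fun _ => ⟨fun h => hne (Fin.ext h.symm), q.2, (key q).2 (Or.inr rfl), ?_⟩⟩
        intro j hj
        rcases (key j).1 hj with rfl | rfl <;> simp
      · refine ⟨p, fun _ => ⟨fun h => hne (Fin.ext h), p.2, (key p).2 (Or.inl rfl), ?_⟩⟩
        intro j hj
        rcases (key j).1 hj with rfl | rfl <;> simp
    · exact ⟨0, fun h => absurd h hi⟩
  choose τ hτ using key
  exact ⟨τ, hτ⟩

theorem IsPairingOf.apply_eq_iff {A : Type*} {N : ℕ} {w : Fin N → A} {τ : ℕ → ℕ}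
    (h : IsPairingOf w τ) (i j : Fin N) : w j = w i ↔ j = i ∨ j.val = τ i := by
  obtain ⟨-, h1, h2, h3⟩ := h i i.2
  constructor
  · intro hj
    exact (h3 j hj).imp_left fun h => Fin.ext h
  · rintro (rfl | hj)
    · rfl
    · rw [← h2]
      congr 1
      exact Fin.ext hj

theorem IsPairingOf.invol {A : Type*} {N : ℕ} {w : Fin N → A} {τ : ℕ → ℕ}
    (h : IsPairingOf w τ) {i : ℕ} (hi : i < N) : τ (τ i) = i := by
  obtain ⟨hne, h1, h2, -⟩ := h i hi
  rcases (h.apply_eq_iff ⟨τ i, h1⟩ ⟨i, hi⟩).1 h2.symm with h3 | h3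
  · exact absurd (congrArg Fin.val h3).symm hne
  · exact h3.symm

end Pairing

namespace AssemblyGraph

/-! ### Forests in the graph of a word as acyclic domino sets -/

section WordForest

variable {A : Type*} {N : ℕ} {w : Fin N → A} {τ : ℕ → ℕ}

/-- The half-edges of the graph of a word on the edges given by a set of dominoes: the domino with
the positions `j` and `j + 1` is the edge `j + 1`. -/
def wordHalfSet (N : ℕ) (M : ℕ → Prop) : Set (Fin (N + 1) × Bool) :=
  {x | ∃ j, M j ∧ x.1.val = j + 1}

/-- A half-edge at a rigid vertex, described by its position in the word. -/
theorem wordVert_eq_inl_iff {x : Fin (N + 1) × Bool} {a : A} :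
    wordVert w x = Sum.inl a ↔ ∃ i : Fin N, w i = a ∧
      (x = (i.castSucc, true) ∨ x = (i.succ, false)) := by
  obtain ⟨i, b⟩ := x
  cases b
  · refine Fin.cases ?_ (fun j => ?_) i
    · simp [wordVert, (Fin.succ_ne_zero _).symm]
    · simp [wordVert]
  · refine Fin.lastCases ?_ (fun j => ?_) i
    · simp [wordVert, (Fin.castSucc_ne_last _).symm]
    · simp [wordVert]

theorem degree_ofWord_inl (hw : IsDoubleOccurrence w) (a : A) :
    (ofWord w hw).degree (Sum.inl a) = 4 := by
  obtain ⟨p, q, hne, hpq⟩ := Set.ncard_eq_two.1 (hw a)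
  change {h | wordVert w h = Sum.inl a}.ncard = 4
  rw [wordVert_eq_inl w a hpq, ← Set.image_univ,
    Set.ncard_image_of_injective _ (injective_word hne)]
  simp

theorem degree_ofWord_inr (hw : IsDoubleOccurrence w) (b : Bool) :
    (ofWord w hw).degree (Sum.inr b) = 1 := by
  change {h | wordVert w h = Sum.inr b}.ncard = 1
  rw [wordVert_eq_inr, Set.ncard_singleton]

/-- The half-edges of a passage through a vertex along the word are not neighbours. -/
theorem not_neighbours_passage (hw : IsDoubleOccurrence w) (i : Fin N) :
    ¬ (ofWord w hw).Neighbours (i.castSucc, true) (i.succ, false) := by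
  rintro ⟨a | b, t, ht, h0, h1⟩
  · obtain ⟨p, q, hne, -, -, ht⟩ := ht
    simp only [cyclicOrder, Set.mem_insert_iff, Set.mem_singleton_iff] at ht
    rcases ht with rfl | rfl | rfl | rfl | rfl | rfl | rfl | rfl <;>
      simp [Fin.ext_iff] at h0 h1 hne <;> omega
  · exact ht

theorem neighbours_ofWord (hw : IsDoubleOccurrence w) {p q : Fin N} (hne : p ≠ q)
    (hpq : w p = w q) {x y : Fin (N + 1) × Bool}
    (hx : x = (p.castSucc, true) ∨ x = (p.succ, false))
    (hy : y = (q.castSucc, true) ∨ y = (q.succ, false)) : (ofWord w hw).Neighbours x y := by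
  have key : ∀ t ∈ cyclicOrder
      ![(p.castSucc, true), (q.castSucc, true), (p.succ, false), (q.succ, false)],
      t ∈ wordOrder w (Sum.inl (w p)) := fun t ht => ⟨p, q, hne, rfl, hpq.symm, ht⟩
  rcases hx with rfl | rfl <;> rcases hy with rfl | rfl
  · exact ⟨Sum.inl (w p), _, key _ (Or.inl rfl), rfl, rfl⟩
  · exact ⟨Sum.inl (w p), ![(p.castSucc, true), (q.succ, false), (p.succ, false),
      (q.castSucc, true)], key _ (by simp [cyclicOrder]), rfl, rfl⟩
  · exact ⟨Sum.inl (w p), ![(p.succ, false), (q.castSucc, true), (p.castSucc, true),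
      (q.succ, false)], key _ (by simp [cyclicOrder]), rfl, rfl⟩
  · exact ⟨Sum.inl (w p), ![(p.succ, false), (q.succ, false), (p.castSucc, true),
      (q.castSucc, true)], key _ (by simp [cyclicOrder]), rfl, rfl⟩

/-- A set of dominoes none of whose nonempty subsets covers an invariant set of positions. -/
def IsAcyclicDominoSet (τ : ℕ → ℕ) (s : Finset ℕ) : Prop :=
  ∀ t ⊆ s, (∀ i, DominoCovers (· ∈ t) i → DominoCovers (· ∈ t) (τ i)) → t = ∅

theorem dominoCovers_iff {M : ℕ → Prop} (i : Fin N) : DominoCovers M i ↔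
    ∃ x ∈ wordHalfSet N M, x = (i.castSucc, true) ∨ x = (i.succ, false) := by
  constructor
  · intro h
    rcases h with h | h
    · exact ⟨_, ⟨i, h, rfl⟩, Or.inr rfl⟩
    -- At the position `0` the truncated `i - 1` is again `0`, so the domino in question starts at
    -- `i` itself.
    · by_cases h0 : i.val = 0
      · exact ⟨(i.succ, false), ⟨i, by rwa [h0] at h ⊢, rfl⟩, Or.inr rfl⟩
      · exact ⟨(i.castSucc, true), ⟨i - 1, h, by simp; omega⟩, Or.inl rfl⟩
  · rintro ⟨x, ⟨j, hj, hxj⟩, rfl | rfl⟩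
    · simp at hxj
      right
      rwa [hxj]
    · simp at hxj
      left
      rwa [hxj]

theorem exists_position {M : ℕ → Prop} (hM : ∀ j, M j → j + 1 < N) {x : Fin (N + 1) × Bool}
    (hx : x ∈ wordHalfSet N M) : ∃ i : Fin N, x = (i.castSucc, true) ∨ x = (i.succ, false) := by
  obtain ⟨⟨e, b⟩, j, hj, hxj⟩ := x, hx
  have := hM j hj
  simp only at hxj
  cases b
  · exact ⟨⟨j, by omega⟩, Or.inr (by simp [Fin.ext_iff, hxj])⟩
  · exact ⟨⟨j + 1, by omega⟩, Or.inl (by simp [Fin.ext_iff, hxj])⟩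

theorem wordVert_position {i : Fin N} {x : Fin (N + 1) × Bool}
    (hx : x = (i.castSucc, true) ∨ x = (i.succ, false)) : wordVert w x = Sum.inl (w i) :=
  wordVert_eq_inl_iff.2 ⟨i, rfl, hx⟩

theorem position_unique {i i' : Fin N} {x : Fin (N + 1) × Bool}
    (hx : x = (i.castSucc, true) ∨ x = (i.succ, false))
    (hx' : x = (i'.castSucc, true) ∨ x = (i'.succ, false)) : i = i' := by
  rcases hx with rfl | rfl <;> simpa using hx'

/-- Disjoint dominoes give at most one half-edge at each position. -/
theorem eq_of_position_eq {M : ℕ → Prop} (hM : ∀ j, M j → ¬ M (j + 1)) {i : Fin N}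
    {x y : Fin (N + 1) × Bool} (hx : x ∈ wordHalfSet N M) (hy : y ∈ wordHalfSet N M)
    (hxi : x = (i.castSucc, true) ∨ x = (i.succ, false))
    (hyi : y = (i.castSucc, true) ∨ y = (i.succ, false)) : x = y := by
  obtain ⟨j, hj, hxj⟩ := hx
  obtain ⟨k, hk, hyk⟩ := hy
  rcases hxi with rfl | rfl <;> rcases hyi with rfl | rfl
  · rfl
  · simp at hxj hyk
    refine absurd hk ?_
    rw [← hyk, hxj]
    exact hM j hj
  · simp at hxj hyk
    refine absurd hj ?_
    rw [← hxj, hyk]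
    exact hM k hk
  · rfl

theorem mem_of_fst_eq (hw : IsDoubleOccurrence w) {T : Set (Fin (N + 1) × Bool)}
    (hT : ∀ h ∈ T, (ofWord w hw).opp h ∈ T) {x y : Fin (N + 1) × Bool} (hx : x ∈ T)
    (h : y.1 = x.1) : y ∈ T := by
  obtain ⟨e, b⟩ := x
  obtain ⟨e', c⟩ := y
  obtain rfl : e' = e := h
  by_cases hbc : c = b
  · rwa [hbc]
  · have := hT _ hx
    rwa [Bool.eq_not.2 hbc]

/-- As the dominoes are disjoint, each covered position carries exactly one half-edge. A second
half-edge at the same vertex is therefore one at the partner position, and cycles of half-edges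
become subsets with `τ`-invariant coverage. -/
theorem isForest_wordHalfSet_iff (hw : IsDoubleOccurrence w) (hτ : IsPairingOf w τ)
    {s : Finset ℕ} (hs : s ∈ dominoSets (N - 1)) :
    (ofWord w hw).IsForest (wordHalfSet N (· ∈ s)) ↔ IsAcyclicDominoSet τ s := by
  obtain ⟨h1, h2⟩ := mem_dominoSets.1 hs
  have h1' : ∀ j ∈ s, j + 1 < N := fun j hj => by have := h1 j hj; omega
  have opp_mem : ∀ M, ∀ h ∈ wordHalfSet N M, (ofWord w hw).opp h ∈ wordHalfSet N M :=
    fun M h hh => hh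
  constructor
  · intro hF t hts hinv
    have := hF.acyclic (wordHalfSet N (· ∈ t)) (fun x ⟨j, hj, hxj⟩ => ⟨j, hts hj, hxj⟩)
      (opp_mem _) ?_
    · by_contra hne
      obtain ⟨j, hj⟩ := Finset.nonempty_iff_ne_empty.2 hne
      have hx : ((⟨j + 1, by have := h1' j (hts hj); omega⟩, false) : Fin (N + 1) × Bool) ∈
        wordHalfSet N (· ∈ t) := ⟨j, hj, rfl⟩
      simp [this] at hx
    · intro x hx
      obtain ⟨i, hi⟩ := exists_position (fun j hj => h1' j (hts hj)) hx
      obtain ⟨hne, hlt, heq, -⟩ := hτ i i.2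
      obtain ⟨y, hy, hyi⟩ := (dominoCovers_iff ⟨τ i, hlt⟩).1
        (hinv i ((dominoCovers_iff i).2 ⟨x, hx, hi⟩))
      refine ⟨y, hy, ?_, ?_⟩
      · rintro rfl
        exact hne (congrArg Fin.val (position_unique hyi hi))
      · change wordVert w y = wordVert w x
        rw [wordVert_position hi, wordVert_position hyi, heq]
  · intro hA
    refine ⟨opp_mem _, ?_, ?_, ?_⟩
    · intro x hx
      obtain ⟨i, hi⟩ := exists_position h1' hx
      have hv : (ofWord w hw).vert x = Sum.inl (w i) := wordVert_position hi
      rw [hv, degree_ofWord_inl]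
    · intro x hx y hy hxy hne
      obtain ⟨i, hi⟩ := exists_position h1' hx
      obtain ⟨i', hi'⟩ := exists_position h1' hy
      change wordVert w x = wordVert w y at hxy
      rw [wordVert_position hi, wordVert_position hi'] at hxy
      refine neighbours_ofWord hw ?_ (Sum.inl_injective hxy) hi hi'
      rintro rfl
      exact hne (eq_of_position_eq h2 hx hy hi hi')
    · intro T' hT' hopp hcyc
      classical
      set t := s.filter fun j => ∃ x ∈ T', x.1.val = j + 1 with ht
      have hT't : T' = wordHalfSet N (· ∈ t) := by
        ext x
        constructor
        · intro hx
          obtain ⟨j, hj, hxj⟩ := hT' hx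
          exact ⟨j, Finset.mem_filter.2 ⟨hj, x, hx, hxj⟩, hxj⟩
        · rintro ⟨j, hj, hxj⟩
          obtain ⟨-, y, hy, hyj⟩ := Finset.mem_filter.1 hj
          exact mem_of_fst_eq hw hopp hy (Fin.ext (hxj.trans hyj.symm))
      have hts : t ⊆ s := Finset.filter_subset _ _
      have ht0 := hA t hts ?_
      · rw [hT't, ht0]
        ext x
        simp [wordHalfSet]
      · intro i hi
        have hiN : i < N := by
          rcases hi with hi | hi <;>
          · have := h1' _ (hts hi)
            omega
        obtain ⟨x, hx, hxi⟩ := (dominoCovers_iff ⟨i, hiN⟩).1 hi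
        rw [← hT't] at hx
        obtain ⟨y, hy, hne, hv⟩ := hcyc x hx
        obtain ⟨i', hi'⟩ := exists_position h1' (hT' hy)
        change wordVert w y = wordVert w x at hv
        rw [wordVert_position hxi, wordVert_position hi'] at hv
        rcases (hτ.apply_eq_iff _ _).1 (Sum.inl_injective hv) with rfl | h
        · exact absurd (eq_of_position_eq h2 (hT' hy) (hT' hx) hi' hxi) hne
        · rw [hT't] at hy
          simp only at h
          rw [← h]
          exact (dominoCovers_iff i').2 ⟨y, hy, hi'⟩

/-- The edges `0` and `N` are excluded because they end at endpoints of the graph. Two overlapping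
dominoes would contain the two half-edges of one passage, which are not neighbours. -/
theorem IsForest.exists_dominoSet (hw : IsDoubleOccurrence w) {T : Set (Fin (N + 1) × Bool)}
    (hT : (ofWord w hw).IsForest T) :
    ∃ s ∈ dominoSets (N - 1), wordHalfSet N (· ∈ s) = T := by
  classical
  have mem_of := fun {x y} => mem_of_fst_eq hw hT.opp_mem (x := x) (y := y)
  have rigid : ∀ x ∈ T, ∃ a, wordVert w x = Sum.inl a := by
    intro x hx
    have h4 := hT.degree_eq_four x hx
    change (ofWord w hw).degree (wordVert w x) = 4 at h4
    rcases h : wordVert w x with a | b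
    · exact ⟨a, rfl⟩
    · rw [h, degree_ofWord_inr] at h4
      omega
  have bounds : ∀ x ∈ T, 0 < x.1.val ∧ x.1.val < N := by
    intro x hx
    constructor
    · by_contra h0
      obtain ⟨a, ha⟩ := rigid (0, false) (mem_of hx (Fin.ext (by simp; omega)))
      simp [wordVert] at ha
    · by_contra h0
      obtain ⟨a, ha⟩ := rigid (Fin.last N, true) (mem_of hx (Fin.ext (by simp; omega)))
      simp [wordVert] at ha
  refine ⟨(Finset.range (N - 1)).filter fun j => ∃ x ∈ T, x.1.val = j + 1,
    mem_dominoSets.2 ⟨fun i hi => ?_, fun i hi hi' => ?_⟩, ?_⟩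
  · exact Finset.mem_range.1 (Finset.mem_filter.1 hi).1
  · obtain ⟨-, x, hx, hxi⟩ := Finset.mem_filter.1 hi
    obtain ⟨hlt, y, hy, hyi⟩ := Finset.mem_filter.1 hi'
    have hlt := Finset.mem_range.1 hlt
    let k : Fin N := ⟨i + 1, by omega⟩
    refine not_neighbours_passage hw k (hT.neighbours _ ?_ _ ?_ ?_ (by simp))
    · exact mem_of hx (Fin.ext (by simp [k, hxi]))
    · exact mem_of hy (Fin.ext (by simp [k, hyi]))
    · exact (wordVert_position (w := w) (i := k) (Or.inl rfl)).trans
        (wordVert_position (w := w) (i := k) (Or.inr rfl)).symm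
  · ext x
    constructor
    · rintro ⟨j, hj, hxj⟩
      obtain ⟨-, y, hy, hyj⟩ := Finset.mem_filter.1 hj
      exact mem_of hy (Fin.ext (hxj.trans hyj.symm))
    · intro hx
      have := bounds x hx
      exact ⟨x.1 - 1, Finset.mem_filter.2 ⟨Finset.mem_range.2 (by omega), x, hx, by omega⟩,
        by omega⟩

open Classical in
theorem ncard_isForest_ofWord (hw : IsDoubleOccurrence w) (hτ : IsPairingOf w τ) :
    {T | (ofWord w hw).IsForest T}.ncard =
      ((dominoSets (N - 1)).filter (IsAcyclicDominoSet τ)).card := by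
  rw [← Set.ncard_coe_finset]
  symm
  refine Set.ncard_congr (fun s _ => wordHalfSet N (· ∈ s)) ?_ ?_ ?_
  · intro s hs
    obtain ⟨h1, h2⟩ := Finset.mem_filter.1 (Finset.mem_coe.1 hs)
    exact (isForest_wordHalfSet_iff hw hτ h1).2 h2
  · intro s t hs ht hst
    have hs := (mem_dominoSets.1 (Finset.mem_filter.1 (Finset.mem_coe.1 hs)).1).1
    have ht := (mem_dominoSets.1 (Finset.mem_filter.1 (Finset.mem_coe.1 ht)).1).1
    have key : ∀ s t : Finset ℕ, (∀ i ∈ s, i < N - 1) →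
        wordHalfSet N (· ∈ s) = wordHalfSet N (· ∈ t) → s ⊆ t := by
      intro s t hs hst i hi
      have := hs i hi
      have hx : ((⟨i + 1, by omega⟩, false) : Fin (N + 1) × Bool) ∈ wordHalfSet N (· ∈ s) :=
        ⟨i, hi, rfl⟩
      rw [hst] at hx
      obtain ⟨j, hj, hij⟩ := hx
      simp at hij
      rwa [hij]
    exact (key s t hs hst).antisymm (key t s ht hst.symm)
  · intro T hT
    obtain ⟨s, hs, rfl⟩ := IsForest.exists_dominoSet hw hT
    exact ⟨s, Finset.mem_coe.2 (Finset.mem_filter.2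
      ⟨hs, (isForest_wordHalfSet_iff hw hτ hs).1 hT⟩), rfl⟩

end WordForest

end AssemblyGraph

/-! ### The bound, the equality case, and rigidity of the tangled cord -/

section Extremal

variable {A : Type*} {n : ℕ} {w : Fin (2 * n) → A} {τ : ℕ → ℕ}

theorem lt_of_dominoCovers {s : Finset ℕ} (hs : s ∈ dominoSets (2 * n - 1)) {i : ℕ}
    (hi : DominoCovers (· ∈ s) i) : i < 2 * n := by
  rcases hi with hi | hi <;>
  · have := (mem_dominoSets.1 hs).1 _ hi
    omega

/-- The set of all positions is invariant under every pairing. -/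
theorem not_isAcyclicDominoSet_perfect (hn : 1 ≤ n) (hτ : IsPairingOf w τ) :
    ¬ AssemblyGraph.IsAcyclicDominoSet τ (perfectDominoSet n) := by
  intro h
  have h0 := h _ subset_rfl fun i hi => by
    obtain ⟨-, hlt, -⟩ := hτ i (lt_of_dominoCovers (perfectDominoSet_mem n) hi)
    exact perfectDominoSet_covers hlt
  have : 0 ∈ perfectDominoSet n := mem_perfectDominoSet.2 ⟨by omega, rfl⟩
  simp [h0] at this

/-- For a rigid pairing, a nonempty invariant subset of `s` already covers everything; then so does
`s`, and `s` is the perfect set. -/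
theorem isRigidPairing_iff (hτ : IsPairingOf w τ) : IsRigidPairing 0 n τ ↔
    ∀ s ∈ dominoSets (2 * n - 1), s ≠ perfectDominoSet n →
      AssemblyGraph.IsAcyclicDominoSet τ s := by
  classical
  constructor
  · intro h s hs hne t hts hinv
    by_contra h0
    obtain ⟨h1, h2⟩ := mem_dominoSets.1 hs
    refine hne (eq_perfectDominoSet hs fun i hi => ?_)
    have := h.full (· ∈ t) ⟨fun j hj => ?_, fun j hj hj' => h2 j (hts hj) (hts hj'), hinv⟩
      (Finset.nonempty_iff_ne_empty.2 h0) i (by omega) hi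
    · exact this.imp (fun h => hts h) (fun h => hts h)
    · have := h1 j (hts hj)
      omega
  · intro h
    refine ⟨fun i _ hi => ?_, fun i _ hi => hτ.invol hi, fun i _ hi => (hτ i hi).1,
      fun M hM hne i _ hi => ?_⟩
    · obtain ⟨-, hlt, -⟩ := hτ i hi
      omega
    · have hMs : ∀ j, j ∈ (Finset.range (2 * n - 1)).filter M ↔ M j := by
        intro j
        rw [Finset.mem_filter, Finset.mem_range, and_iff_right_iff_imp]
        intro hj
        have := hM.bounds j hj
        omega
      generalize (Finset.range (2 * n - 1)).filter M = s at hMs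
      obtain rfl : M = (· ∈ s) := funext fun j => propext (hMs j).symm
      have hs : s ∈ dominoSets (2 * n - 1) :=
        mem_dominoSets.2 ⟨fun j hj => by have := hM.bounds j hj; omega, hM.disjoint⟩
      by_cases hsp : s = perfectDominoSet n
      · rw [hsp]
        exact perfectDominoSet_covers hi
      · obtain ⟨j, hj⟩ := hne
        rw [h s hs hsp s subset_rfl hM.invariant] at hj
        simp at hj

-- The acyclic domino sets lie among the imperfect ones, so equality of cardinalities means that
-- every imperfect set is acyclic.
open Classical in
theorem card_acyclicDominoSets (hn : 1 ≤ n) (hτ : IsPairingOf w τ) :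
    ((dominoSets (2 * n - 1)).filter (AssemblyGraph.IsAcyclicDominoSet τ)).card ≤
        Nat.fib (2 * n + 1) - 1 ∧
      (((dominoSets (2 * n - 1)).filter (AssemblyGraph.IsAcyclicDominoSet τ)).card =
        Nat.fib (2 * n + 1) - 1 ↔ IsRigidPairing 0 n τ) := by
  have hsub : (dominoSets (2 * n - 1)).filter (AssemblyGraph.IsAcyclicDominoSet τ) ⊆
      (dominoSets (2 * n - 1)).erase (perfectDominoSet n) := by
    intro s hs
    obtain ⟨h1, h2⟩ := Finset.mem_filter.1 hs
    refine Finset.mem_erase.2 ⟨?_, h1⟩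
    rintro rfl
    exact not_isAcyclicDominoSet_perfect hn hτ h2
  have hcard : ((dominoSets (2 * n - 1)).erase (perfectDominoSet n)).card =
      Nat.fib (2 * n + 1) - 1 := by
    rw [Finset.card_erase_of_mem (perfectDominoSet_mem n), card_dominoSets]
    congr 2
    omega
  rw [← hcard]
  refine ⟨Finset.card_le_card hsub, ?_⟩
  rw [isRigidPairing_iff hτ]
  constructor
  · intro h s hs hne
    have := Finset.eq_of_subset_of_card_le hsub h.ge
    have hmem : s ∈ (dominoSets (2 * n - 1)).erase (perfectDominoSet n) :=
      Finset.mem_erase.2 ⟨hne, hs⟩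
    rw [← this] at hmem
    exact (Finset.mem_filter.1 hmem).2
  · intro h
    congr 1
    refine hsub.antisymm fun s hs => ?_
    obtain ⟨h1, h2⟩ := Finset.mem_erase.1 hs
    exact Finset.mem_filter.2 ⟨h2, h s h2 h1⟩

/-- In the tangled cord, the partner of a positive even position precedes it. -/
theorem tangledCord_pairing (hτ : IsPairingOf (tangledCordWord n) τ) {k : ℕ} (hk : 2 * k + 2 < 2 * n) :
    τ (2 * k + 2) = 2 * k - 1 := by
  -- For `k = 0` the truncated `2 * k - 1` is `0`, which is the correct partner of the position `2`.
  have := (hτ.apply_eq_iff ⟨2 * k + 2, hk⟩ ⟨2 * k - 1, by omega⟩).1 (by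
    simp only [tangledCordWord, Fin.mk.injEq]
    split_ifs <;> omega)
  rcases this with h | h
  · simp only [Fin.mk.injEq] at h
    omega
  · exact h.symm

theorem isRigidPairing_tangledCord (hτ : IsPairingOf (tangledCordWord n) τ) :
    IsRigidPairing 0 n τ := by
  refine ⟨fun i _ hi => ?_, fun i _ hi => hτ.invol hi, fun i _ hi => (hτ i hi).1,
    fun M hM hne i _ hi => ?_⟩
  · obtain ⟨-, hlt, -⟩ := hτ i hi
    omega
  have back : ∀ k, 2 * k + 2 < 2 * n → DominoCovers M (2 * k + 2) → DominoCovers M (2 * k - 1) :=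
    fun k hk h => tangledCord_pairing hτ hk ▸ hM.invariant _ h
  have forth : ∀ k, 2 * k + 2 < 2 * n → DominoCovers M (2 * k - 1) → DominoCovers M (2 * k + 2) :=
    fun k hk h => by
      have := hM.invariant _ h
      rwa [← tangledCord_pairing hτ hk, hτ.invol hk] at this
  -- If the smallest domino `j` were positive, it would cover a positive even position, whose
  -- partner could be covered only by a smaller domino.
  have h0 : M 0 := by
    classical
    have hj := Nat.find_spec hne
    have hmin := fun {m} => Nat.find_min hne (m := m)
    set j := Nat.find hne
    have hb := hM.bounds j hj
    rcases Nat.eq_zero_or_pos j with h | hpos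
    · rwa [h] at hj
    exfalso
    have hc : DominoCovers M (2 * ((j - 1) / 2) - 1) := by
      refine back _ (by omega) ?_
      rcases Nat.even_or_odd' j with ⟨k, h | h⟩
      · left
        rwa [show 2 * ((j - 1) / 2) + 2 = j by omega]
      · right
        rwa [show 2 * ((j - 1) / 2) + 2 - 1 = j by omega]
    rcases hc with h | h <;> exact hmin (by omega) h
  -- The dominoes found so far cover `2 * k - 1`, hence its partner `2 * k + 2` is covered. The
  -- domino `2 * k + 1` would overlap `2 * k`, which leaves the domino `2 * k + 2`.
  have heven : ∀ k, k < n → M (2 * k) := by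
    intro k
    induction k using Nat.strong_induction_on with
    | _ k ih =>
      intro hk
      rcases k with _ | k
      · exact h0
      have hc : DominoCovers M (2 * k - 1) := by
        right
        have := ih (k - 1) (by omega) (by omega)
        rwa [show 2 * k - 1 - 1 = 2 * (k - 1) by omega]
      rcases forth k (by omega) hc with h | h
      · exact h
      · exact absurd h (hM.disjoint _ (ih k (by omega) (by omega)))
  have := heven (i / 2) (by omega)
  rcases Nat.even_or_odd' i with ⟨k, h | h⟩
  · left
    rwa [show 2 * (i / 2) = i by omega] at this
  · right
    rwa [show 2 * (i / 2) = i - 1 by omega] at this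

end Extremal

/-! ### The length of the word and the theorem -/

namespace AssemblyGraph

theorem length_eq_of_isDoubleOccurrence {A : Type*} [Finite A] {N : ℕ} {w : Fin N → A}
    (hw : IsDoubleOccurrence w) : N = 2 * Nat.card A := by
  classical
  have := Fintype.ofFinite A
  have h := Finset.card_eq_sum_card_fiberwise (f := w) (s := Finset.univ) (t := Finset.univ)
    (fun _ _ => Finset.mem_coe.2 (Finset.mem_univ _))
  have h2 : ∀ a, (Finset.univ.filter fun i => w i = a).card = 2 := by
    intro a
    rw [← hw a, ← Set.ncard_coe_finset]
    simp
  simp only [h2] at h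
  simpa [mul_comm] using h

end AssemblyGraph

theorem mainTheorem1 {V H : Type*} [Finite V] [Finite H] (Γ : AssemblyGraph V H)
    (hΓ : Γ.IsSimple) (n : ℕ) (hn : 1 ≤ n) (hcard : Γ.numRigid = n) :
    Γ.hamiltonianSets.ncard ≤ Nat.fib (2 * n + 1) - 1 ∧
    (Γ.hamiltonianSets.ncard = Nat.fib (2 * n + 1) - 1 ↔ Nonempty (Γ.Iso (tangledCord n))) := by
  obtain ⟨N, w, hw, ⟨e⟩⟩ := hΓ.exists_iso_ofWord
  obtain rfl : N = 2 * n := by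
    rw [AssemblyGraph.length_eq_of_isDoubleOccurrence hw, ← hcard]
    rfl
  obtain ⟨τ, hτ⟩ := hw.exists_pairing
  obtain ⟨σ, hσ⟩ := (isDoubleOccurrence_tangledCordWord n).exists_pairing
  have hrigid := isRigidPairing_tangledCord hσ
  rw [AssemblyGraph.ncard_hamiltonianSets]
  have hcount := card_acyclicDominoSets hn hτ
  rw [← AssemblyGraph.ncard_isForest_ofWord hw hτ, e.ncard_isForest] at hcount
  refine ⟨hcount.1, fun h => ?_, fun ⟨e'⟩ => ?_⟩
  -- Both pairings are rigid, hence equal on all positions, so the two words have equal letters at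
  -- the same places.
  · obtain ⟨e'⟩ := AssemblyGraph.nonempty_iso_ofWord hw (isDoubleOccurrence_tangledCordWord n)
      fun i j => by
        rw [hτ.apply_eq_iff j i, hσ.apply_eq_iff j i,
          (hcount.2.1 h).unique hrigid (by omega) j.2]
    exact ⟨e.trans e'⟩
  · rw [← e'.ncard_isForest]
    refine Eq.trans ?_ ((card_acyclicDominoSets hn hσ).2.2 hrigid)
    exact AssemblyGraph.ncard_isForest_ofWord _ hσ
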